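/- **Notation.** Let $\tau\in\mathbb C$, $\mathrm{Im}\,\tau>0$, $\mathbf e(x)=e^{2\pi i x}$, let $\theta(z|\tau)$ be the odd theta function, $\phi(x,z|\tau)=\frac{\theta(x+z)\theta'(0)}{\theta(x)\theta(z)}$ and $E_2(z|\tau)=-\partial_z^2\log\theta(z|\tau)$. Let $n\ge 0$, $l=\lfloor n/2\rfloor$, $\bar k=n+1-k$. For an $n\times n$ matrix put $\tilde A=jA^{T}j$ with $j=(\delta_{p,\bar q})_{p,q}$. On $\mathrm{sl}(2n,\mathbb C)$, in $n\times n$ blocks, let $$\nu\begin{pmatrix}A&B\\ C&D\end{pmatrix}=\begin{pmatrix}-\tilde D&\tilde B\\ \tilde C&-\tilde A\end{pmatrix},\qquad \Lambda=\begin{pmatrix}0&1\\1&0\end{pmatrix}.$$ For $\vec u=(u_1,\dots,u_l)$ let $\hat u=(u_1,\dots,u_l,-u_l,\dots,-u_1)$ ($n$ even) or $(u_1,\dots,u_l,0,-u_l,\dots,-u_1)$ ($n$ odd), $u_{jk}=\hat u_j-\hat u_k$, $\mathbf u=\mathrm{diag}(\hat u,\hat u)$. Assume that $\vec u$ is generic: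 $u_{jk}+\frac{a+b\tau}2\notin\mathbb Z+\mathbb Z\tau$ for all $j\ne k$ and $a,b\in\{0,1\}$. For $\alpha,a,b\in\{0,1\}$ put $$T^{\alpha}_{(a,b),jk}=\sigma\otimes\bigl(E_{jk}+\varepsilon E_{\bar k\bar j}\bigr),$$ where $\sigma=\sigma_0,\sigma_1,\sigma_3,\sigma_2$ for $(\alpha,a)=(0,0),(1,0),(0,1),(1,1)$, and $\varepsilon=-(-1)^b$ if $(\alpha,a)=(0,0)$, $\varepsilon=(-1)^b$ otherwise. The non-zero ones among these matrices with $j+k\le n+1$ form a basis of $\mathrm{gl}(2n,\mathbb C)$, homogeneous for the $\mathbb Z_2\oplus\mathbb Z_2$-grading by $(\mathrm{Ad}_\Lambda,\nu)=((-1)^a,(-1)^b)$. For $S\in\mathrm{sl}(2n,\mathbb C)$ write $S=\sum_{\alpha,a,b}\sum_{j+k\le n+1}S^\alpha_{(a,b),jk}T^\alpha_{(a,b),jk}$, with $S^\alpha_{(a,b),jk}=0$ when $T^\alpha_{(a,b),jk}=0$; explicitly, $S^\alpha_{(a,b),jk}=\tfrac14\mathrm{tr}(S\,T^\alpha_{(a,b),kj})$,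 with $\tfrac18$ in place of $\tfrac14$ if $j+k=n+1$. Put $H_{(0,0),j}=T^0_{(0,0),jj}$, $j\le l$. A *Lax operator* for the bundle with transitions $\nu$ and $\mathbf e(\mathbf u)\Lambda$, with residue $S$, is a meromorphic $\mathrm{sl}(2n,\mathbb C)$-valued function $L$ of $t=e^{\pi i z}$, holomorphic for $z\notin\mathbb Z+\mathbb Z\tau$, such that, written as a function of $z$, $$L(z+1)=\nu(L(z)),\qquad L(z+\tau)=\mathrm{Ad}_{\mathbf e(\mathbf u)\Lambda}L(z),$$ and $L$ has at $z=0$ at most a simple pole with residue $S$ (with respect to $dz$). **Theorem.** Let $S\in \mathrm{sl}(2n,\mathbb C)$. 1. (Lax operator.) Lax operators with residue $S$ exist if and only if $S^\alpha_{(0,0),jj}=0$ for all $\alpha$ and all $j\le\frac{n+1}2$. In that case they are exactly the functions $$L(z)=\sum_{j=1}^l v_jH_{(0,0),j}+\sum_{\alpha,a,b}\ \sum_{\substack{j+k\le n+1\\ j\ne k\text{ if }a=b=0}}S^\alpha_{(a,b),jk}\,\mathbf e\!\left(\tfrac{bz}2\right)\phi\!\left(-u_{jk}+\tfrac{a+b\tau}2,z\,\Big|\,\tau\right)T^\alpha_{(a,b),jk}+\sum_{j\le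 (n+1)/2}w_jT^1_{(0,0),jj}$$ with constants $v\in\mathbb C^l$, $w\in\mathbb C^{\lfloor (n+1)/2\rfloor}$, uniquely determined by $L$. (The Lax operator of the Calogero-Moser system, with momenta $v_j$ conjugate to $u_j$, is the one with $w=0$.) 2. (Quadratic Hamiltonian.) In that case $$\tfrac18\mathrm{tr}\,L(z)^2=H(v,u,S)+c(w)+E_2(z|\tau)\cdot\tfrac18\mathrm{tr}\,S^2,$$ where $c(w)=\tfrac12\sum_{j\le l}w_j^2$, plus $w_{(n+1)/2}^2$ if $n$ is odd (so $c(0)=0$), and, with $\omega_{ab}=\frac{a+b\tau}2$, $E_2(\cdot)=E_2(\cdot|\tau)$ and $s_{jk}=S^\alpha_{(a,b),jk}$, $$\begin{aligned}H=\ &\tfrac12\sum_{j=1}^lv_j^2-\sum_{\alpha}\sum_{(a,b)\ne(0,0)}\Bigl(\tfrac12\sum_{j=1}^l s_{jj}^2+\Bigl[s_{mm}^2\Bigr]\Bigr)E_2(\omega_{ab})\\&-\sum_{\alpha,a,b}\Bigl(\ \sum_{1\le j<k\le l}\bigl(s_{jk}s_{kj}\,E_2(u_j-u_k+\omega_{ab})+s_{j\bar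 k}s_{\bar kj}\,E_2(u_j+u_k+\omega_{ab})\bigr)\\&\qquad+\Bigl[\sum_{j=1}^l s_{jm}s_{mj}\,E_2(u_j+\omega_{ab})\Bigr]+2\sum_{j=1}^l s_{j\bar j}s_{\bar jj}\,E_2(2u_j+\omega_{ab})\Bigr),\end{aligned}$$ where $m=\frac{n+1}2$ and the terms in square brackets are present only for odd $n$. (Terms whose generator is zero are absent, since their coordinate vanishes; for example the last sum has no term with $(a,b)=(1,1)$.) -/

import Mathlib

open Matrix Filter Topology

noncomputable section

namespace TwistedCM

/-! ### Elliptic functions (in the additive variable `z`, with period lattice `ℤ + ℤ τ`) -/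

/-- The period lattice `ℤ + ℤ τ`. -/
def lattice (τ : ℂ) : Set ℂ := {z | ∃ m k : ℤ, z = m + k * τ}

/-- The odd theta function
`θ(z|τ) = ∑ₘ exp (π i (m + 1/2)² τ + 2 π i (m + 1/2) (z + 1/2))`. -/
def theta (τ z : ℂ) : ℂ :=
  Complex.exp (Real.pi * Complex.I * (τ / 4 + z + 1 / 2)) * jacobiTheta₂ (z + 1 / 2 + τ / 2) τ

/-- The Kronecker function `φ(x, z|τ) = θ(x + z) θ'(0) / (θ(x) θ(z))`. -/
def kronecker (τ x z : ℂ) : ℂ :=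
  theta τ (x + z) * deriv (theta τ) 0 / (theta τ x * theta τ z)

/-- The first Eisenstein function `E₁(z|τ) = ∂_z log θ(z|τ) = θ'(z) / θ(z)`. -/
def E1 (τ z : ℂ) : ℂ := deriv (theta τ) z / theta τ z

/-- The second Eisenstein function `E₂(z|τ) = - ∂_z E₁(z|τ) = - ∂_z² log θ(z|τ)`. -/
def E2 (τ z : ℂ) : ℂ := -deriv (E1 τ) z

/-- `𝐞(x) = exp (2 π i x)`. -/
def ee (x : ℂ) : ℂ := Complex.exp (2 * Real.pi * Complex.I * x)

/-- The half-period `(a + b τ) / 2`. -/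
def halfPeriod (τ : ℂ) (a b : Fin 2) : ℂ := ((a : ℕ) + (b : ℕ) * τ) / 2

/-! ### The two transition automorphisms of `sl(2n)`

`2n × 2n` matrices are written in `n × n` blocks, `x = (A, B; C, D)`; rows and columns are
numbered by `Fin n ⊕ Fin n`. -/

/-- `2n × 2n` complex matrices in block form. -/
abbrev Mat (n : ℕ) := Matrix (Fin n ⊕ Fin n) (Fin n ⊕ Fin n) ℂ

/-- Transposition with respect to the anti-diagonal, `Ã = j Aᵀ j`, `j` the reversal matrix. -/
def tilde {n : ℕ} (A : Matrix (Fin n) (Fin n) ℂ) : Matrix (Fin n) (Fin n) ℂ :=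
  Matrix.of fun j k => A k.rev j.rev

/-- The outer automorphism `ν (A, B; C, D) = (-D̃, B̃; C̃, -Ã)` of `sl(2n)`; its fixed
subalgebra is the symplectic algebra. -/
def nu {n : ℕ} (x : Mat n) : Mat n :=
  Matrix.fromBlocks (-tilde x.toBlocks₂₂) (tilde x.toBlocks₁₂)
    (tilde x.toBlocks₂₁) (-tilde x.toBlocks₁₁)

/-- `Λ = (0, 1; 1, 0)`. -/
def Lam (n : ℕ) : Mat n := Matrix.fromBlocks 0 1 1 0

/-- For `u = (u₁, …, u_l)`, `l = ⌊n/2⌋`, the vector `(u₁, …, u_l, -u_l, …, -u₁)` of length `n`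
for even `n`, and `(u₁, …, u_l, 0, -u_l, …, -u₁)` for odd `n`. -/
def hatU {n : ℕ} (u : Fin (n / 2) → ℂ) (j : Fin n) : ℂ :=
  if h : j.val < n / 2 then u ⟨j.val, h⟩
  else if h' : j.rev.val < n / 2 then -u ⟨j.rev.val, h'⟩
  else 0

/-- The matrix `𝐞(𝐮) Λ`, where `𝐮 = diag(û, û)`. -/
def transitionMatrix {n : ℕ} (u : Fin (n / 2) → ℂ) : Mat n :=
  Matrix.diagonal (Sum.elim (fun j => ee (hatU u j)) (fun j => ee (hatU u j))) * Lam n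

/-- `Ad_{𝐞(𝐮) Λ}`. -/
def AdT {n : ℕ} (u : Fin (n / 2) → ℂ) (x : Mat n) : Mat n :=
  transitionMatrix u * x * (transitionMatrix u)⁻¹

/-- The Lax operators of the bundle with transitions `ν` and `𝐞(𝐮) Λ` and with residue `S` at the
marked point. The multiplicative coordinate is `t = exp (π i z)`, so that `t ↦ -t` is
`z ↦ z + 1`, `t ↦ exp (π i τ) t` is `z ↦ z + τ`, and `t = 1` is `z = 0`. The residue is taken
with respect to `dz`. (As `ν² = 1`, `L` has period `2` and so is a function of `t`.) -/
structure IsLaxOperator {n : ℕ} (τ : ℂ) (u : Fin (n / 2) → ℂ) (S : Mat n) (L : ℂ → Mat n) :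
    Prop where
  trace_eq_zero : ∀ z ∉ lattice τ, (L z).trace = 0
  holomorphic : ∀ p q, DifferentiableOn ℂ (fun z => L z p q) (lattice τ)ᶜ
  nu_equivariant : ∀ z ∉ lattice τ, L (z + 1) = nu (L z)
  ad_equivariant : ∀ z ∉ lattice τ, L (z + τ) = AdT u (L z)
  residue : Tendsto (fun z => z • L z) (𝓝[≠] 0) (𝓝 S)

/-! ### The basis adapted to the `ℤ/2 × ℤ/2`-grading by `(Ad_Λ, ν)` -/

/-- The sigma matrix in the generators `T^α_{(a,b)}`: `σ₀`, `σ₁` for `a = 0` and `σ₃`, `σ₂` for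
`a = 1` (`α = 0`, `α = 1` respectively). -/
def pauli : Fin 2 → Fin 2 → Matrix (Fin 2) (Fin 2) ℂ
  | 0, 0 => 1
  | 1, 0 => !![0, 1; 1, 0]
  | 0, 1 => !![1, 0; 0, -1]
  | 1, 1 => !![0, -Complex.I; Complex.I, 0]

/-- The sign in `T^α_{(a,b)}`, chosen so that `ν` multiplies `T^α_{(a,b)}` by `(-1)^b`. -/
def sgn (α a b : Fin 2) : ℂ :=
  if α = 0 ∧ a = 0 then -(-1) ^ (b : ℕ) else (-1) ^ (b : ℕ)

/-- `T^α_{(a,b),jk} = σ ⊗ (E_{jk} ± E_{n-k+1,n-j+1})`. For `j + k ≤ n + 1` the non-zero ones among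
these form a basis of `gl(2n)`; `Ad_Λ` and `ν` multiply them by `(-1)^a` and `(-1)^b`. -/
def T {n : ℕ} (α a b : Fin 2) (j k : Fin n) : Mat n :=
  let X : Matrix (Fin n) (Fin n) ℂ :=
    Matrix.single j k 1 + sgn α a b • Matrix.single k.rev j.rev 1
  Matrix.fromBlocks (pauli α a 0 0 • X) (pauli α a 0 1 • X)
    (pauli α a 1 0 • X) (pauli α a 1 1 • X)

/-- The index pairs of the basis: `j + k ≤ n + 1` for `j, k` numbered from `1`. -/
def pairs (n : ℕ) : Finset (Fin n × Fin n) :=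
  Finset.univ.filter fun p => p.1.val + p.2.val < n

/-- The value of `tr (T^α_{(a,b),jk} T^α_{(a,b),kj})` for a non-zero generator. -/
def normT {n : ℕ} (j k : Fin n) : ℂ := if k = j.rev then 8 else 4

/-- The coordinate `S^α_{(a,b),jk}` of `S` along `T^α_{(a,b),jk}` (zero if that matrix is zero):
the generators `T^α_{(a,b),jk}` and `T^α_{(a,b),kj}` are dual to each other under the trace form
up to the factor `normT j k`. -/
def coord {n : ℕ} (S : Mat n) (α a b : Fin 2) (j k : Fin n) : ℂ :=
  (S * T α a b k j).trace / normT j k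

/-- The index `j ≤ ⌊n/2⌋` as an index `≤ n`. -/
def lo {n : ℕ} (j : Fin (n / 2)) : Fin n := Fin.castLE (Nat.div_le_self n 2) j

/-- The index `j ≤ ⌊(n+1)/2⌋` as an index `≤ n`. -/
def lo' {n : ℕ} (j : Fin ((n + 1) / 2)) : Fin n := Fin.castLE (by omega) j

/-- The middle index `(n+1)/2` if `n` is odd, no index if `n` is even. -/
def middle (n : ℕ) : Finset (Fin n) := Finset.univ.filter fun m => m.rev = m

/-! ### The Lax operator and the Hamiltonian -/

/-- The explicit Lax operator
`∑ v_j H_{(0,0),j} + ∑ S^α_{(a,b),jk} 𝐞(b z / 2) φ(-u_{jk} + (a + b τ) / 2, z|τ) T^α_{(a,b),jk}`,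
where `H_{(0,0),j} = T⁰_{(0,0),jj}`, `u_{jk} = û_j - û_k`, and the second sum is over the basis
without the elements `T^α_{(0,0),jj}`. -/
def laxOperator {n : ℕ} (τ : ℂ) (u v : Fin (n / 2) → ℂ) (S : Mat n) (z : ℂ) : Mat n :=
  ∑ j, v j • T 0 0 0 (lo j) (lo j) +
  ∑ α : Fin 2, ∑ a : Fin 2, ∑ b : Fin 2,
    ∑ p ∈ (pairs n).filter (fun p => ¬(a = 0 ∧ b = 0 ∧ p.1 = p.2)),
      (coord S α a b p.1 p.2 * ee ((b : ℕ) * z / 2) *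
        kronecker τ (-(hatU u p.1 - hatU u p.2) + halfPeriod τ a b) z) • T α a b p.1 p.2

/-- The constant matrix `∑ w_j T¹_{(0,0),jj}`; it commutes with `𝐮`, `Λ` and is fixed by `ν`. -/
def centralTerm {n : ℕ} (w : Fin ((n + 1) / 2) → ℂ) : Mat n :=
  ∑ j, w j • T 1 0 0 (lo' j) (lo' j)

/-- The quadratic Hamiltonian. -/
def hamiltonian {n : ℕ} (τ : ℂ) (u v : Fin (n / 2) → ℂ) (S : Mat n) : ℂ :=
  (1 / 2) * ∑ j, v j ^ 2 -
  ∑ α : Fin 2, ∑ a : Fin 2, ∑ b : Fin 2,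
    let s : Fin n → Fin n → ℂ := coord S α a b
    let ω : ℂ := halfPeriod τ a b
    ((if a = 0 ∧ b = 0 then 0 else
        ((1 / 2) * ∑ j, s (lo j) (lo j) ^ 2 + ∑ m ∈ middle n, s m m ^ 2) * E2 τ ω) +
      (∑ j, ∑ k with j < k,
        (s (lo j) (lo k) * s (lo k) (lo j) * E2 τ (u j - u k + ω) +
          s (lo j) (lo k).rev * s (lo k).rev (lo j) * E2 τ (u j + u k + ω))) +
      (∑ j, ∑ m ∈ middle n, s (lo j) m * s m (lo j) * E2 τ (u j + ω)) +
      2 * ∑ j, s (lo j) (lo j).rev * s (lo j).rev (lo j) * E2 τ (2 * u j + ω))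

end TwistedCM

end

/-! The generators `T` diagonalise both transition automorphisms: `nu` acts on T^α_{(a,b),jk} by
(-1)^b (`nu_T`) and `AdT` by (-1)^a e(u_jk) (`AdT_T`). They are also dual to each other under the
trace form, T_jk pairing only with T_kj (`trace_T_mul_T_pairs`), and they span
(`eq_combination_coord`). The equivariance of a Lax operator therefore decouples into one scalar
problem per coordinate: find the functions with prescribed constant multipliers under z + 1 and z +
τ and with at most a simple pole at 0, whose residue is the coordinate of S.

If the multipliers are not those with a = b = 0 and j = k, genericity keeps -u_jk + ω_ab off the
lattice, and the only solution is the residue times e(bz/2) φ(-u_jk + ω_ab, z)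
(`eq_mul_ee_mul_kronecker`). If a = b = 0 and j = k, the function is elliptic with at most one
simple pole per cell, so its residue vanishes and it is constant (`residue_eq_zero_and_const`). This
gives both the condition on S and the free constants v and w. At the middle index the generator
T^0_{(0,0),jj} is zero, so v has no component there while w does.

For the Hamiltonian, duality reduces tr L² to products of the jk and kj coefficients. With x = u_jk
+ ω_ab, the arguments of the two Kronecker functions are x and -x up to the period 2ω_ab. The
quasi-periodicity factor cancels the exponential prefactors, and φ(x,z) φ(-x,z) = E₂(z) - E₂(x)
(`kronecker_mul_kronecker_neg`). The E₂(z) parts add up to tr S²; the rest, folded by the symmetry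
in j and k (`sum_pairs_symm`), is H + c(w).

The elliptic function theory rests on Liouville's theorem. The zeros of θ come from comparison with
an infinite product (`exists_theta_eq_mul_thetaProduct`), and the vanishing of the residue comes
from the additive quasi-period of E₁, without contour integration. -/

namespace TwistedCM

/-! ### The period lattice -/

/-- The period lattice as an additive subgroup. -/
def latticeSubgroup (τ : ℂ) : AddSubgroup ℂ where
  carrier := lattice τ
  add_mem' := by
    rintro _ _ ⟨m, k, rfl⟩ ⟨m', k', rfl⟩
    exact ⟨m + m', k + k', by push_cast; ring⟩
  zero_mem' := ⟨0, 0, by simp⟩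
  neg_mem' := by
    rintro _ ⟨m, k, rfl⟩
    exact ⟨-m, -k, by push_cast; ring⟩

theorem zero_mem_lattice (τ : ℂ) : (0 : ℂ) ∈ lattice τ := (latticeSubgroup τ).zero_mem

theorem one_mem_lattice (τ : ℂ) : (1 : ℂ) ∈ lattice τ := ⟨1, 0, by simp⟩

theorem tau_mem_lattice (τ : ℂ) : τ ∈ lattice τ := ⟨0, 1, by simp⟩

theorem neg_mem_lattice {τ z : ℂ} : -z ∈ lattice τ ↔ z ∈ lattice τ :=
  neg_mem_iff (H := latticeSubgroup τ)

theorem add_mem_lattice {τ z l : ℂ} (hl : l ∈ lattice τ) : z + l ∈ lattice τ ↔ z ∈ lattice τ :=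
  (latticeSubgroup τ).add_mem_cancel_right hl

theorem ne_zero_of_notMem_lattice {τ z : ℂ} (hz : z ∉ lattice τ) : z ≠ 0 :=
  fun h => hz (h ▸ zero_mem_lattice τ)

theorem min_le_norm_of_mem_lattice {τ : ℂ} (hτ : 0 < τ.im) {z : ℂ} (hz : z ∈ lattice τ)
    (h0 : z ≠ 0) : min 1 τ.im ≤ ‖z‖ := by
  obtain ⟨m, k, rfl⟩ := hz
  by_cases hk : k = 0
  · subst hk
    have hm : m ≠ 0 := by rintro rfl; simp at h0
    have : (1 : ℝ) ≤ |(m : ℝ)| := by exact_mod_cast Int.one_le_abs hm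
    simpa using Or.inl this
  · have h1 : (1 : ℝ) ≤ |(k : ℝ)| := by exact_mod_cast Int.one_le_abs hk
    have h2 : |((m : ℂ) + k * τ).im| ≤ ‖(m : ℂ) + k * τ‖ := Complex.abs_im_le_norm _
    have h3 : ((m : ℂ) + k * τ).im = k * τ.im := by simp
    rw [h3, abs_mul, abs_of_pos hτ] at h2
    refine (min_le_right _ _).trans (le_trans ?_ h2)
    nlinarith

/-- Distinct lattice points are at least δ apart, so a ball of radius δ/2 contains at most one of
them. If that one differs from c, the neighbourhood is shrunk to avoid it. -/
theorem eventually_notMem_lattice {τ : ℂ} (hτ : 0 < τ.im) (c : ℂ) :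
    ∀ᶠ z in 𝓝[≠] c, z ∉ lattice τ := by
  set δ := min 1 τ.im with hδ
  have hδ0 : 0 < δ := lt_min one_pos hτ
  by_cases h : ∃ l ∈ lattice τ, l ≠ c ∧ dist l c < δ / 2
  · obtain ⟨l, hl, hlc, hd⟩ := h
    have h1 : ∀ᶠ z in 𝓝[≠] c, dist z c < δ / 2 :=
      (nhdsWithin_le_nhds (Metric.ball_mem_nhds c (by positivity)))
    have h2 : ∀ᶠ z in 𝓝[≠] c, z ≠ l :=
      nhdsWithin_le_nhds (isOpen_ne.mem_nhds hlc.symm)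
    filter_upwards [h1, h2] with z hz hzl hmem
    have h3 := min_le_norm_of_mem_lattice hτ
      ((latticeSubgroup τ).sub_mem hmem hl) (sub_ne_zero.2 hzl)
    have h4 := dist_triangle_right z l c
    rw [dist_eq_norm z l] at h4
    linarith
  · push Not at h
    have h1 : ∀ᶠ z in 𝓝[≠] c, dist z c < δ / 2 :=
      (nhdsWithin_le_nhds (Metric.ball_mem_nhds c (by positivity)))
    filter_upwards [h1, self_mem_nhdsWithin] with z hz hzc hmem
    exact absurd (h z hmem hzc) (not_le.2 hz)

theorem isOpen_compl_lattice {τ : ℂ} (hτ : 0 < τ.im) : IsOpen (lattice τ)ᶜ := by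
  rw [isOpen_iff_mem_nhds]
  intro z hz
  have := eventually_notMem_lattice hτ z
  rw [eventually_nhdsWithin_iff] at this
  filter_upwards [this] with w hw
  by_cases h : w = z
  · rwa [h]
  · exact hw h

theorem dense_compl_lattice {τ : ℂ} (hτ : 0 < τ.im) : Dense (lattice τ)ᶜ := by
  intro z
  rw [mem_closure_iff_frequently]
  exact (eventually_notMem_lattice hτ z).frequently.filter_mono nhdsWithin_le_nhds

theorem exists_add_lattice_mem {τ : ℂ} (hτ : 0 < τ.im) (z : ℂ) :
    ∃ m k : ℤ, ∃ s ∈ Set.Icc (0 : ℝ) 1, ∃ t ∈ Set.Icc (0 : ℝ) 1, z = (s + t * τ) + (m + k * τ) := by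
  set y := z.im / τ.im
  set x := z.re - y * τ.re
  refine ⟨⌊x⌋, ⌊y⌋, Int.fract x, ⟨Int.fract_nonneg _, (Int.fract_lt_one _).le⟩, Int.fract y,
    ⟨Int.fract_nonneg _, (Int.fract_lt_one _).le⟩, ?_⟩
  have hx : ((Int.fract x : ℝ) : ℂ) = x - ⌊x⌋ := by
    rw [← Int.self_sub_floor]; push_cast; rfl
  have hy : ((Int.fract y : ℝ) : ℂ) = y - ⌊y⌋ := by
    rw [← Int.self_sub_floor]; push_cast; rfl
  have : z = x + y * τ := by
    apply Complex.ext
    · simp [x]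
    · simp [y, hτ.ne']
  rw [hx, hy]
  linear_combination this

/-! ### Functions with affine multipliers -/

/-- The periods that have an affine multiplier form a subgroup, and it contains 1 and τ. Inverting a
multiplier is what requires c ≠ 0. The additive terms are needed for functions built from E₁. -/
theorem exists_affine_multiplier {τ : ℂ} {D : Set ℂ} (hD : ∀ l ∈ lattice τ, ∀ z, z + l ∈ D ↔ z ∈ D)
    {f : ℂ → ℂ} {a b a' b' : ℂ} (ha : a ≠ 0) (ha' : a' ≠ 0)
    (h1 : ∀ z ∈ D, f (z + 1) = a * f z + b)
    (h2 : ∀ z ∈ D, f (z + τ) = a' * f z + b') {l : ℂ} (hl : l ∈ lattice τ) :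
    ∃ c d : ℂ, c ≠ 0 ∧ ∀ z ∈ D, f (z + l) = c * f z + d := by
  let H : AddSubgroup ℂ :=
    { carrier := {l | l ∈ lattice τ ∧ ∃ c d : ℂ, c ≠ 0 ∧ ∀ z ∈ D, f (z + l) = c * f z + d}
      add_mem' := by
        rintro x y ⟨hx, c, d, hc, h⟩ ⟨hy, c', d', hc', h'⟩
        refine ⟨(latticeSubgroup τ).add_mem hx hy, c' * c, c' * d + d', mul_ne_zero hc' hc,
          fun z hz => ?_⟩
        rw [← add_assoc, h' _ ((hD x hx z).2 hz), h z hz]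
        ring
      zero_mem' := ⟨zero_mem_lattice τ, 1, 0, one_ne_zero, by simp⟩
      neg_mem' := by
        rintro x ⟨hx, c, d, hc, h⟩
        have hx' := neg_mem_lattice.2 hx
        refine ⟨hx', c⁻¹, -c⁻¹ * d, inv_ne_zero hc, fun z hz => ?_⟩
        have := h (z + -x) ((hD _ hx' z).2 hz)
        rw [neg_add_cancel_right] at this
        rw [this]
        field_simp
        ring }
  have e1 : (1 : ℂ) ∈ H := ⟨one_mem_lattice τ, a, b, ha, h1⟩
  have e2 : τ ∈ H := ⟨tau_mem_lattice τ, a', b', ha', h2⟩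
  obtain ⟨m, k, rfl⟩ := hl
  have := H.add_mem (H.zsmul_mem e1 m) (H.zsmul_mem e2 k)
  rw [zsmul_eq_mul, zsmul_eq_mul, mul_one] at this
  exact this.2

theorem notMem_lattice_translate (τ : ℂ) :
    ∀ l ∈ lattice τ, ∀ z, z + l ∈ (lattice τ)ᶜ ↔ z ∈ (lattice τ)ᶜ :=
  fun _ hl _ => not_congr (add_mem_lattice hl)

/-- Liouville: an entire doubly periodic function is constant. -/
theorem apply_eq_of_doubly_periodic {τ : ℂ} (hτ : 0 < τ.im) {f : ℂ → ℂ} (hf : Differentiable ℂ f)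
    (h1 : ∀ z, f (z + 1) = f z) (h2 : ∀ z, f (z + τ) = f z) (z w : ℂ) : f z = f w := by
  refine hf.apply_eq_apply_of_bounded ?_ z w
  have hper : ∀ m k : ℤ, ∀ z, f (z + (m + k * τ)) = f z := by
    intro m k z
    have p1 : Function.Periodic f 1 := h1
    have p2 : Function.Periodic f τ := h2
    rw [← add_assoc, p2.int_mul k, ← mul_one (m : ℂ), p1.int_mul m]
  let g : ℝ × ℝ → ℂ := fun p => f (p.1 + p.2 * τ)
  have hg : Continuous g := by
    have := hf.continuous
    fun_prop
  have hK : IsCompact (g '' (Set.Icc (0 : ℝ) 1 ×ˢ Set.Icc (0 : ℝ) 1)) :=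
    (isCompact_Icc.prod isCompact_Icc).image hg
  refine hK.isBounded.subset ?_
  rintro _ ⟨z, rfl⟩
  obtain ⟨m, k, s, hs, t, ht, rfl⟩ := exists_add_lattice_mem hτ z
  exact ⟨(s, t), ⟨hs, ht⟩, (hper m k _).symm⟩

/-- Removable singularities at the points of the lattice. -/
theorem exists_entire_extension {τ : ℂ} (hτ : 0 < τ.im) {f : ℂ → ℂ}
    (hf : DifferentiableOn ℂ f (lattice τ)ᶜ)
    (h0 : ∀ l ∈ lattice τ, Tendsto (fun z => (z - l) * f z) (𝓝[≠] l) (𝓝 0)) :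
    ∃ F : ℂ → ℂ, Differentiable ℂ F ∧ ∀ z ∉ lattice τ, F z = f z := by
  classical
  refine ⟨fun z => if z ∈ lattice τ then limUnder (𝓝[≠] z) f else f z, fun c => ?_,
    fun z hz => if_neg hz⟩
  by_cases hc : c ∈ lattice τ
  · have hev := eventually_notMem_lattice hτ c
    set s : Set ℂ := {z | z ≠ c → z ∉ lattice τ}
    have hs : s ∈ 𝓝 c := eventually_nhdsWithin_iff.1 hev
    have hd : DifferentiableOn ℂ f (s \ {c}) := hf.mono fun z hz => hz.1 hz.2
    have hne : ∀ᶠ z in 𝓝[≠] c, (z - c)⁻¹ ≠ 0 := by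
      filter_upwards [self_mem_nhdsWithin] with z hz
      exact inv_ne_zero (sub_ne_zero.2 hz)
    -- Riemann's theorem is used in its little-o form. The arbitrary value `f c` enters only through
    -- (z - c) `f c`, which tends to 0.
    have ho : (fun z => f z - f c) =o[𝓝[≠] c] fun z => (z - c)⁻¹ := by
      rw [Asymptotics.isLittleO_iff_tendsto' (hne.mono fun z hz h => absurd h hz)]
      have h2 : Tendsto (fun z => (z - c) * f c) (𝓝[≠] c) (𝓝 0) := by
        have : Tendsto (fun z => (z - c) * f c) (𝓝 c) (𝓝 ((c - c) * f c)) :=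
          Continuous.tendsto (by fun_prop) c
        rw [sub_self, zero_mul] at this
        exact this.mono_left nhdsWithin_le_nhds
      have h3 := (h0 c hc).sub h2
      rw [sub_zero] at h3
      refine h3.congr fun z => ?_
      rw [div_inv_eq_mul]
      ring
    have hu := Complex.differentiableOn_update_limUnder_of_isLittleO hs hd ho
    refine (hu.differentiableAt hs).congr_of_eventuallyEq ?_
    filter_upwards [hs] with z hz
    by_cases hzc : z = c
    · subst hzc; simp [hc]
    · rw [if_neg (hz hzc), Function.update_of_ne hzc]
  · refine (hf.differentiableAt ((isOpen_compl_lattice hτ).mem_nhds hc)).congr_of_eventuallyEq ?_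
    filter_upwards [(isOpen_compl_lattice hτ).mem_nhds hc] with z hz
    exact if_neg hz

theorem eq_of_eq_off_lattice {τ : ℂ} (hτ : 0 < τ.im) {f g : ℂ → ℂ} (hf : Continuous f)
    (hg : Continuous g) (h : ∀ z ∉ lattice τ, f z = g z) (z : ℂ) : f z = g z :=
  congr_fun (hf.ext_on (dense_compl_lattice hτ) hg fun z hz => h z hz) z

/-- A pole is controlled only at 0 by hypothesis; the multiplier carries this control to l. The
additive constant is killed by the factor z. -/
theorem tendsto_sub_mul_of_affine_multiplier {τ : ℂ} (hτ : 0 < τ.im) {f : ℂ → ℂ} {l c d r : ℂ}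
    (h : ∀ z ∈ (lattice τ)ᶜ, f (z + l) = c * f z + d)
    (hr : Tendsto (fun z => z * f z) (𝓝[≠] 0) (𝓝 r)) :
    Tendsto (fun z => (z - l) * f z) (𝓝[≠] l) (𝓝 (c * r)) := by
  have hsub : Tendsto (fun z => z - l) (𝓝[≠] l) (𝓝[≠] 0) := by
    refine tendsto_nhdsWithin_of_tendsto_nhds_of_eventually_within _ ?_ ?_
    · have : Tendsto (fun z => z - l) (𝓝 l) (𝓝 (l - l)) := Continuous.tendsto (by fun_prop) l
      rw [sub_self] at this
      exact this.mono_left nhdsWithin_le_nhds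
    · filter_upwards [self_mem_nhdsWithin] with z hz
      exact sub_ne_zero.2 hz
  have hd : Tendsto (fun z : ℂ => z * d) (𝓝[≠] 0) (𝓝 0) := by
    have : Tendsto (fun z : ℂ => z * d) (𝓝 0) (𝓝 (0 * d)) := Continuous.tendsto (by fun_prop) 0
    rw [zero_mul] at this
    exact this.mono_left nhdsWithin_le_nhds
  have h1 := ((hr.const_mul c).add hd)
  rw [add_zero] at h1
  have h2 : Tendsto (fun z => z * f (z + l)) (𝓝[≠] 0) (𝓝 (c * r)) := by
    refine h1.congr' ?_
    filter_upwards [eventually_notMem_lattice hτ 0] with z hz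
    rw [h z hz]
    ring
  refine (h2.comp hsub).congr fun z => ?_
  simp

/-- A function with affine multipliers and without a pole at `0` extends to an entire function. -/
theorem exists_entire_extension_of_affine_multipliers {τ : ℂ} (hτ : 0 < τ.im) {f : ℂ → ℂ}
    {a b a' b' : ℂ} (ha : a ≠ 0) (ha' : a' ≠ 0) (hf : DifferentiableOn ℂ f (lattice τ)ᶜ)
    (h1 : ∀ z ∉ lattice τ, f (z + 1) = a * f z + b)
    (h2 : ∀ z ∉ lattice τ, f (z + τ) = a' * f z + b')
    (h0 : Tendsto (fun z => z * f z) (𝓝[≠] 0) (𝓝 0)) :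
    ∃ F : ℂ → ℂ, Differentiable ℂ F ∧ (∀ z ∉ lattice τ, F z = f z) ∧
      (∀ z, F (z + 1) = a * F z + b) ∧ ∀ z, F (z + τ) = a' * F z + b' := by
  obtain ⟨F, hF, hFf⟩ := exists_entire_extension hτ hf fun l hl => by
    obtain ⟨c, d, -, h⟩ :=
      exists_affine_multiplier (notMem_lattice_translate τ) ha ha' h1 h2 hl
    simpa using tendsto_sub_mul_of_affine_multiplier hτ h h0
  have hFc := hF.continuous
  refine ⟨F, hF, hFf, eq_of_eq_off_lattice hτ (by fun_prop) (by fun_prop) fun z hz => ?_,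
    eq_of_eq_off_lattice hτ (by fun_prop) (by fun_prop) fun z hz => ?_⟩
  · rw [hFf z hz, hFf _ (fun h => hz ((add_mem_lattice (one_mem_lattice τ)).1 h)), h1 z hz]
  · rw [hFf z hz, hFf _ (fun h => hz ((add_mem_lattice (tau_mem_lattice τ)).1 h)), h2 z hz]

/-- A doubly periodic function without poles is constant. -/
theorem exists_eq_const_of_doubly_periodic {τ : ℂ} (hτ : 0 < τ.im) {f : ℂ → ℂ}
    (hf : DifferentiableOn ℂ f (lattice τ)ᶜ)
    (h1 : ∀ z ∉ lattice τ, f (z + 1) = f z) (h2 : ∀ z ∉ lattice τ, f (z + τ) = f z)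
    (h0 : Tendsto (fun z => z * f z) (𝓝[≠] 0) (𝓝 0)) : ∃ c, ∀ z ∉ lattice τ, f z = c := by
  obtain ⟨F, hF, hFf, e1, e2⟩ := exists_entire_extension_of_affine_multipliers hτ (a := 1) (b := 0)
    (a' := 1) (b' := 0) one_ne_zero one_ne_zero hf (by simpa using h1) (by simpa using h2) h0
  refine ⟨F 0, fun z hz => ?_⟩
  rw [← hFf z hz]
  exact apply_eq_of_doubly_periodic hτ hF (by simpa using e1) (by simpa using e2) z 0

/-! ### The theta function: multipliers -/

theorem theta_differentiable {τ : ℂ} (hτ : 0 < τ.im) : Differentiable ℂ (theta τ) := by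
  intro z
  unfold theta
  have h := (differentiableAt_jacobiTheta₂_fst (z + 1 / 2 + τ / 2) hτ)
  have h2 : DifferentiableAt ℂ (fun z : ℂ => z + 1 / 2 + τ / 2) z := by fun_prop
  have h3 := DifferentiableAt.comp z h h2
  exact DifferentiableAt.mul (by fun_prop) h3

theorem exp_add_pi_mul_I (x : ℂ) :
    Complex.exp (x + Real.pi * Complex.I) = -Complex.exp x := by
  rw [Complex.exp_add, Complex.exp_pi_mul_I]; ring

theorem theta_add_one (τ z : ℂ) : theta τ (z + 1) = -theta τ z := by
  unfold theta
  rw [show z + 1 + 1 / 2 + τ / 2 = (z + 1 / 2 + τ / 2) + 1 by ring, jacobiTheta₂_add_left,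
    ← neg_mul, ← exp_add_pi_mul_I]
  ring_nf

theorem theta_add_tau (τ z : ℂ) : theta τ (z + τ) =
    -Complex.exp (-(Real.pi * Complex.I * (τ + 2 * z))) * theta τ z := by
  unfold theta
  rw [show z + τ + 1 / 2 + τ / 2 = (z + 1 / 2 + τ / 2) + τ by ring, jacobiTheta₂_add_left',
    ← mul_assoc, ← mul_assoc, ← exp_add_pi_mul_I, ← Complex.exp_add, ← Complex.exp_add]
  have : Complex.exp (2 * Real.pi * Complex.I) = 1 := Complex.exp_two_pi_mul_I
  congr 1
  rw [show -(Real.pi * Complex.I * (τ + 2 * z)) + Real.pi * Complex.I +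
      Real.pi * Complex.I * (τ / 4 + z + 1 / 2) =
    (Real.pi * Complex.I * (τ / 4 + (z + τ) + 1 / 2) +
      -Real.pi * Complex.I * (τ + 2 * (z + 1 / 2 + τ / 2))) + 2 * Real.pi * Complex.I by ring,
    Complex.exp_add _ (2 * Real.pi * Complex.I), this, mul_one]

theorem theta_neg (τ z : ℂ) : theta τ (-z) = -theta τ z := by
  unfold theta
  -- The argument belonging to z is minus the argument belonging to -z, shifted by 1 + τ. Evenness
  -- of `jacobiTheta₂` and its two quasi-periods then give the claim.
  rw [show z + 1 / 2 + τ / 2 = (-(-z + 1 / 2 + τ / 2) + τ) + 1 by ring, jacobiTheta₂_add_left,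
    jacobiTheta₂_add_left', jacobiTheta₂_neg_left, ← mul_assoc, ← neg_mul, ← Complex.exp_add]
  congr 1
  rw [← exp_add_pi_mul_I]
  have : Complex.exp (2 * Real.pi * Complex.I) = 1 := Complex.exp_two_pi_mul_I
  rw [show Real.pi * Complex.I * (τ / 4 + z + 1 / 2) +
      -Real.pi * Complex.I * (τ + 2 * -(-z + 1 / 2 + τ / 2)) + Real.pi * Complex.I =
    Real.pi * Complex.I * (τ / 4 + -z + 1 / 2) + 2 * Real.pi * Complex.I by ring,
    Complex.exp_add _ (2 * Real.pi * Complex.I), this, mul_one]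

theorem theta_zero (τ : ℂ) : theta τ 0 = 0 := by
  have := theta_neg τ 0
  rw [neg_zero] at this
  exact CharZero.eq_neg_self_iff.1 this

/-- The zeroth Fourier coefficient is 1: integrated over [0, 1], every term with n ≠ 0 vanishes. On
the real line the norms of the terms do not depend on x, so termwise integration is allowed. -/
theorem exists_jacobiTheta₂_ne_zero {τ : ℂ} (hτ : 0 < τ.im) : ∃ z, jacobiTheta₂ z τ ≠ 0 := by
  by_contra! h
  let F : ℤ → C(ℝ, ℂ) := fun n => ⟨fun x => jacobiTheta₂_term n x τ, by
    unfold jacobiTheta₂_term; fun_prop⟩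
  have hnorm : ∀ n : ℤ, ∀ x : ℝ, ‖F n x‖ = ‖jacobiTheta₂_term n 0 τ‖ := fun n x => by
    simp [F, norm_jacobiTheta₂_term]
  have hs := (hasSum_jacobiTheta₂_term 0 hτ).summable.norm
  have hsum : Summable fun n => ‖(F n).restrict
      (⟨Set.uIcc (0 : ℝ) 1, isCompact_uIcc⟩ : TopologicalSpace.Compacts ℝ)‖ := by
    refine hs.of_nonneg_of_le (fun _ => norm_nonneg _) fun n => ?_
    rw [ContinuousMap.norm_le _ (norm_nonneg _)]
    exact fun x => (hnorm n x).le
  have h1 := intervalIntegral.hasSum_intervalIntegral_of_summable_norm hsum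
  have h2 : ∀ x : ℝ, ∑' n, F n x = 0 := fun x => h x
  simp only [h2, intervalIntegral.integral_zero] at h1
  have h3 : ∀ n : ℤ, n ≠ 0 → ∫ x in (0 : ℝ)..1, F n x = 0 := fun n hn => by
    have e : ∀ x : ℝ, F n x = Complex.exp ((2 * Real.pi * Complex.I * n) * x) *
        Complex.exp (Real.pi * Complex.I * n ^ 2 * τ) := fun x => by
      simp only [F, ContinuousMap.coe_mk, jacobiTheta₂_term, Complex.exp_add]
    have hc : 2 * Real.pi * Complex.I * n ≠ 0 :=
      mul_ne_zero Complex.two_pi_I_ne_zero (by exact_mod_cast hn)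
    simp only [e]
    rw [intervalIntegral.integral_mul_const, integral_exp_mul_complex hc]
    have : Complex.exp (2 * Real.pi * Complex.I * n) = 1 := by
      rw [mul_comm]; exact Complex.exp_int_mul_two_pi_mul_I n
    simp [this]
  have h4 : ∫ x in (0 : ℝ)..1, F 0 x = 1 := by
    simp [F, jacobiTheta₂_term]
  have h5 := (hasSum_single 0 h3).unique h1
  rw [h4] at h5
  exact one_ne_zero h5

theorem exists_theta_ne_zero {τ : ℂ} (hτ : 0 < τ.im) : ∃ z, theta τ z ≠ 0 := by
  obtain ⟨z, hz⟩ := exists_jacobiTheta₂_ne_zero hτ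
  refine ⟨z - 1 / 2 - τ / 2, mul_ne_zero (Complex.exp_ne_zero _) ?_⟩
  rwa [show z - 1 / 2 - τ / 2 + 1 / 2 + τ / 2 = z by ring]

/-! ### The product `∏ (1 - qⁿ x)` and the zeros of theta -/

/-- The infinite product `∏_{n ≥ 0} (1 - qⁿ x)`. -/
noncomputable def qProduct (q x : ℂ) : ℂ := ∏' n : ℕ, (1 + -(q ^ n * x))

theorem summable_norm_qProduct {q : ℂ} (hq : ‖q‖ < 1) (x : ℂ) :
    Summable fun n : ℕ => ‖-(q ^ n * x)‖ := by
  simpa using (summable_geometric_of_lt_one (norm_nonneg q) hq).mul_right ‖x‖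

theorem qProduct_ne_zero {q : ℂ} (hq : ‖q‖ < 1) {x : ℂ} (h : ∀ n : ℕ, q ^ n * x ≠ 1) :
    qProduct q x ≠ 0 :=
  tprod_one_add_ne_zero_of_summable (fun n h0 => h n (by linear_combination -h0))
    (summable_norm_qProduct hq x)

theorem qProduct_eq {q : ℂ} (hq : ‖q‖ < 1) (x : ℂ) :
    qProduct q x = (1 - x) * qProduct q (q * x) := by
  unfold qProduct
  have hm : Multipliable fun n : ℕ => (1 + -(q ^ (n + 1) * x)) := by
    apply multipliable_one_add_of_summable
    exact (summable_nat_add_iff 1).2 (summable_norm_qProduct hq x)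
  rw [tprod_eq_zero_mul' (f := fun n : ℕ => 1 + -(q ^ n * x)) hm, pow_zero, one_mul,
    ← sub_eq_add_neg]
  congr 1
  refine tprod_congr fun n => ?_
  rw [pow_succ, mul_assoc]

theorem qProduct_differentiable {q : ℂ} (hq : ‖q‖ < 1) : Differentiable ℂ (qProduct q) := by
  intro x
  -- Majorant for the factors on the unit ball around x.
  have hu := (summable_geometric_of_lt_one (norm_nonneg q) hq).mul_right (‖x‖ + 1)
  have := Summable.hasProdLocallyUniformlyOn_nat_one_add (f := fun n x => -(q ^ n * x))
    (Metric.isOpen_ball (x := x) (ε := 1)) hu (.of_forall fun n y hy => by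
      rw [norm_neg, norm_mul, norm_pow]
      gcongr
      have h1 := norm_le_norm_add_norm_sub' y x
      rw [Metric.mem_ball, dist_eq_norm] at hy
      linarith) (fun n => by fun_prop)
  have hd := this.differentiableOn (.of_forall fun s => by
    simpa [Finset.prod_fn] using DifferentiableOn.finsetProd (fun _ _ ↦ by fun_prop))
    Metric.isOpen_ball
  exact hd.differentiableAt (Metric.ball_mem_nhds x one_pos)

/-- The product form of the theta function, up to a constant. -/
noncomputable def thetaProduct (τ z : ℂ) : ℂ :=
  Complex.exp (-(Real.pi * Complex.I * z)) * (1 - ee z) *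
    (qProduct (ee τ) (ee τ * ee z) * qProduct (ee τ) (ee τ * ee (-z)))

theorem ee_add (x y : ℂ) : ee (x + y) = ee x * ee y := by
  unfold ee; rw [← Complex.exp_add]; ring_nf

theorem ee_ne_zero (x : ℂ) : ee x ≠ 0 := Complex.exp_ne_zero _

theorem ee_zero : ee 0 = 1 := by simp [ee]

theorem ee_one : ee 1 = 1 := by simp [ee, Complex.exp_two_pi_mul_I]

theorem ee_neg (x : ℂ) : ee (-x) = (ee x)⁻¹ := by
  unfold ee; rw [← Complex.exp_neg]; ring_nf

theorem ee_eq_one_iff {x : ℂ} : ee x = 1 ↔ ∃ n : ℤ, x = n := by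
  unfold ee
  rw [Complex.exp_eq_one_iff]
  refine exists_congr fun n => ?_
  rw [mul_comm (n : ℂ)]
  exact mul_right_inj' Complex.two_pi_I_ne_zero

theorem ee_differentiable : Differentiable ℂ ee := by unfold ee; fun_prop

theorem norm_ee_lt_one {τ : ℂ} (hτ : 0 < τ.im) : ‖ee τ‖ < 1 := by
  unfold ee
  rw [Complex.norm_exp, Real.exp_lt_one_iff]
  have : (2 * Real.pi * Complex.I * τ).re = -(2 * Real.pi * τ.im) := by simp
  rw [this]
  have := Real.pi_pos
  have : 0 < 2 * Real.pi * τ.im := by positivity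
  linarith

theorem ee_natMul (n : ℕ) (x : ℂ) : ee (n * x) = ee x ^ n := by
  unfold ee; rw [← Complex.exp_nat_mul]; ring_nf

/-- A vanishing factor would make (n + 1)τ + z an integer. This puts z in the lattice, or
contradicts Im τ > 0 when z = 0. The case z = 0 serves the derivative of the product at 0. -/
theorem qProduct_ee_ne_zero {τ : ℂ} (hτ : 0 < τ.im) {z : ℂ} (hz : z ∉ lattice τ ∨ z = 0) :
    qProduct (ee τ) (ee τ * ee z) ≠ 0 := by
  refine qProduct_ne_zero (norm_ee_lt_one hτ) fun n h => ?_
  rw [← mul_assoc, ← pow_succ, ← ee_natMul, ← ee_add, ee_eq_one_iff] at h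
  obtain ⟨m, hm⟩ := h
  rcases hz with hz | rfl
  · exact hz ⟨m, -(n + 1 : ℕ), by push_cast at hm ⊢; linear_combination hm⟩
  · have := congr_arg Complex.im hm
    rw [add_zero, ← Complex.ofReal_natCast, Complex.im_ofReal_mul] at this
    have h1 : (0 : ℝ) < ((n + 1 : ℕ) : ℝ) := by positivity
    have h2 := mul_pos h1 hτ
    rw [this] at h2
    simp at h2

theorem thetaProduct_ne_zero {τ : ℂ} (hτ : 0 < τ.im) {z : ℂ} (hz : z ∉ lattice τ) :
    thetaProduct τ z ≠ 0 := by
  refine mul_ne_zero (mul_ne_zero (Complex.exp_ne_zero _) fun h => ?_)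
    (mul_ne_zero (qProduct_ee_ne_zero hτ (Or.inl hz))
      (qProduct_ee_ne_zero hτ (Or.inl fun h => hz (neg_mem_lattice.1 h))))
  obtain ⟨n, hn⟩ := ee_eq_one_iff.1 (sub_eq_zero.1 h).symm
  exact hz ⟨n, 0, by simpa using hn⟩

theorem thetaProduct_differentiable {τ : ℂ} (hτ : 0 < τ.im) :
    Differentiable ℂ (thetaProduct τ) := by
  have h1 := qProduct_differentiable (norm_ee_lt_one hτ)
  have h2 := ee_differentiable
  unfold thetaProduct
  fun_prop

theorem thetaProduct_zero (τ : ℂ) : thetaProduct τ 0 = 0 := by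
  simp [thetaProduct, ee_zero]

theorem thetaProduct_add_one (τ z : ℂ) : thetaProduct τ (z + 1) = -thetaProduct τ z := by
  unfold thetaProduct
  rw [neg_add, ee_add z, ee_add (-z), ee_neg 1, ee_one,
    show -(Real.pi * Complex.I * (z + 1)) =
      -(Real.pi * Complex.I * z) - Real.pi * Complex.I by ring, Complex.exp_sub,
    Complex.exp_pi_mul_I]
  ring_nf

/-- Put q = e(τ). The shift moves each product by one factor: the first loses 1 - q e(z), which the
new prefactor 1 - e(z + τ) restores, and the second gains 1 - e(-z) = -e(-z)(1 - e(z)). -/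
theorem thetaProduct_add_tau {τ : ℂ} (hτ : 0 < τ.im) (z : ℂ) : thetaProduct τ (z + τ) =
    -Complex.exp (-(Real.pi * Complex.I * (τ + 2 * z))) * thetaProduct τ z := by
  have hq := norm_ee_lt_one hτ
  have e1 := qProduct_eq hq (ee τ * ee z)
  have e2 := qProduct_eq hq (ee (-z))
  have e3 : ee τ * ee (-(z + τ)) = ee (-z) := by rw [← ee_add]; ring_nf
  have e4 : ee (-z) * ee z = 1 := by rw [← ee_add]; simp [ee_zero]
  have e5 : Complex.exp (-(Real.pi * Complex.I * (τ + 2 * z))) *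
      Complex.exp (-(Real.pi * Complex.I * z)) =
      Complex.exp (-(Real.pi * Complex.I * (z + τ))) * ee (-z) := by
    unfold ee; rw [← Complex.exp_add, ← Complex.exp_add]; ring_nf
  unfold thetaProduct
  rw [e3, e2, e1, ee_add z τ, mul_comm (ee z)]
  linear_combination (1 - ee z) * ((1 - ee τ * ee z) *
    qProduct (ee τ) (ee τ * (ee τ * ee z)) * qProduct (ee τ) (ee τ * ee (-z))) * e5 -
    Complex.exp (-(Real.pi * Complex.I * (z + τ))) * ((1 - ee τ * ee z) *
    qProduct (ee τ) (ee τ * (ee τ * ee z)) * qProduct (ee τ) (ee τ * ee (-z))) * e4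

/-- Only the factor 1 - e(z) vanishes at 0, and it does so to first order. -/
theorem deriv_thetaProduct_zero_ne_zero {τ : ℂ} (hτ : 0 < τ.im) :
    deriv (thetaProduct τ) 0 ≠ 0 := by
  have hq := qProduct_differentiable (norm_ee_lt_one hτ)
  have hee := ee_differentiable
  let g : ℂ → ℂ := fun z => Complex.exp (-(Real.pi * Complex.I * z)) *
    (qProduct (ee τ) (ee τ * ee z) * qProduct (ee τ) (ee τ * ee (-z)))
  have hg : Differentiable ℂ g := by fun_prop
  have h1 : HasDerivAt (fun z => 1 - ee z) (-(2 * Real.pi * Complex.I)) 0 := by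
    unfold ee
    have := (((hasDerivAt_id (0 : ℂ)).const_mul (2 * Real.pi * Complex.I)).cexp).const_sub 1
    simpa using this
  have h2 := h1.mul (hg 0).hasDerivAt
  have e : thetaProduct τ = (fun z => 1 - ee z) * g := by
    funext z
    simp only [thetaProduct, g, Pi.mul_apply]
    ring
  rw [e, h2.deriv, ee_zero]
  have hne := qProduct_ee_ne_zero hτ (Or.inr rfl)
  simp only [sub_self, zero_mul, add_zero, g, neg_zero, mul_zero, Complex.exp_zero, one_mul]
  exact mul_ne_zero (neg_ne_zero.2 Complex.two_pi_I_ne_zero) (mul_ne_zero hne hne)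

theorem tendsto_div_of_hasDerivAt {f : ℂ → ℂ} {d : ℂ} (hf : HasDerivAt f d 0) (h0 : f 0 = 0) :
    Tendsto (fun z => f z / z) (𝓝[≠] 0) (𝓝 d) := by
  have := hasDerivAt_iff_tendsto_slope.1 hf
  refine this.congr fun z => ?_
  simp [slope, h0, div_eq_inv_mul]

theorem tendsto_id_div_of_hasDerivAt {f : ℂ → ℂ} {d : ℂ} (hf : HasDerivAt f d 0) (h0 : f 0 = 0)
    (hd : d ≠ 0) : Tendsto (fun z => z / f z) (𝓝[≠] 0) (𝓝 d⁻¹) := by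
  refine ((tendsto_div_of_hasDerivAt hf h0).inv₀ hd).congr fun z => ?_
  rw [inv_div]

/-- Both sides have the same multipliers, so their quotient is elliptic. The simple zero of the
product at 0 is compensated by θ(0) = 0, hence the quotient is constant by Liouville. This transfers
the known zeros of the product to θ. -/
theorem exists_theta_eq_mul_thetaProduct {τ : ℂ} (hτ : 0 < τ.im) :
    ∃ c : ℂ, c ≠ 0 ∧ ∀ z, theta τ z = c * thetaProduct τ z := by
  have ht := theta_differentiable hτ
  have hp := thetaProduct_differentiable hτ
  obtain ⟨c, hc⟩ := exists_eq_const_of_doubly_periodic hτ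
    (f := fun z => theta τ z / thetaProduct τ z)
    (fun z hz => ((ht z).div (hp z) (thetaProduct_ne_zero hτ hz)).differentiableWithinAt)
    (fun z hz => by rw [theta_add_one, thetaProduct_add_one, neg_div_neg_eq])
    (fun z hz => by
      rw [theta_add_tau, thetaProduct_add_tau hτ, mul_div_mul_left]
      exact neg_ne_zero.2 (Complex.exp_ne_zero _))
    (by
      have h1 := tendsto_id_div_of_hasDerivAt (hp 0).hasDerivAt (thetaProduct_zero τ)
        (deriv_thetaProduct_zero_ne_zero hτ)
      have h2 : Tendsto (theta τ) (𝓝[≠] 0) (𝓝 (theta τ 0)) :=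
        (ht.continuous.tendsto 0).mono_left nhdsWithin_le_nhds
      rw [theta_zero] at h2
      have h3 := h2.mul h1
      rw [zero_mul] at h3
      exact h3.congr fun z => by ring)
  have h : ∀ z, theta τ z = c * thetaProduct τ z :=
    eq_of_eq_off_lattice hτ ht.continuous (by have := hp.continuous; fun_prop) fun z hz => by
      rw [← hc z hz, div_mul_cancel₀ _ (thetaProduct_ne_zero hτ hz)]
  refine ⟨c, fun h0 => ?_, h⟩
  obtain ⟨z, hz⟩ := exists_theta_ne_zero hτ
  exact hz (by rw [h z, h0, zero_mul])

theorem theta_ne_zero {τ : ℂ} (hτ : 0 < τ.im) {z : ℂ} (hz : z ∉ lattice τ) : theta τ z ≠ 0 := by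
  obtain ⟨c, hc, h⟩ := exists_theta_eq_mul_thetaProduct hτ
  rw [h]
  exact mul_ne_zero hc (thetaProduct_ne_zero hτ hz)

theorem deriv_theta_zero_ne_zero {τ : ℂ} (hτ : 0 < τ.im) : deriv (theta τ) 0 ≠ 0 := by
  obtain ⟨c, hc, h⟩ := exists_theta_eq_mul_thetaProduct hτ
  rw [funext h, deriv_const_mul _ (thetaProduct_differentiable hτ 0)]
  exact mul_ne_zero hc (deriv_thetaProduct_zero_ne_zero hτ)

/-! ### The Eisenstein functions -/

theorem E1_add_one (τ z : ℂ) : E1 τ (z + 1) = E1 τ z := by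
  have h : deriv (theta τ) (z + 1) = -deriv (theta τ) z := by
    rw [← deriv_comp_add_const, funext (theta_add_one τ), deriv.fun_neg]
  rw [E1, E1, h, theta_add_one, neg_div_neg_eq]

theorem E1_neg (τ z : ℂ) : E1 τ (-z) = -E1 τ z := by
  have h : deriv (theta τ) (-z) = deriv (theta τ) z := by
    have := deriv_comp_neg (theta τ) z
    rw [funext (theta_neg τ), deriv.fun_neg] at this
    exact (neg_injective this).symm
  rw [E1, E1, h, theta_neg, div_neg]

/-- The additive constant is the logarithmic derivative of the multiplier -exp(-πi(τ + 2z)) of θ. -/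
theorem E1_add_tau {τ : ℂ} (hτ : 0 < τ.im) {z : ℂ} (hz : z ∉ lattice τ) :
    E1 τ (z + τ) = E1 τ z - 2 * Real.pi * Complex.I := by
  have h : deriv (theta τ) (z + τ) = 2 * Real.pi * Complex.I *
      Complex.exp (-(Real.pi * Complex.I * (τ + 2 * z))) * theta τ z -
      Complex.exp (-(Real.pi * Complex.I * (τ + 2 * z))) * deriv (theta τ) z := by
    rw [← deriv_comp_add_const, funext (theta_add_tau τ)]
    have h1 : HasDerivAt (fun z => -Complex.exp (-(Real.pi * Complex.I * (τ + 2 * z))))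
        (2 * Real.pi * Complex.I * Complex.exp (-(Real.pi * Complex.I * (τ + 2 * z)))) z := by
      have := (((((hasDerivAt_id z).const_mul 2).const_add τ).const_mul
        (Real.pi * Complex.I)).fun_neg.cexp).fun_neg
      refine this.congr_deriv ?_
      simp only [id]
      ring
    rw [(h1.fun_mul (theta_differentiable hτ z).hasDerivAt).deriv]
    ring
  have h1 := theta_ne_zero hτ hz
  have h2 := Complex.exp_ne_zero (-(Real.pi * Complex.I * (τ + 2 * z)))
  rw [E1, E1, h, theta_add_tau]
  field_simp
  ring

theorem deriv_theta_differentiable {τ : ℂ} (hτ : 0 < τ.im) :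
    Differentiable ℂ (deriv (theta τ)) := (theta_differentiable hτ).deriv

theorem E1_differentiableAt {τ : ℂ} (hτ : 0 < τ.im) {z : ℂ} (hz : z ∉ lattice τ) :
    DifferentiableAt ℂ (E1 τ) z :=
  (deriv_theta_differentiable hτ z).div (theta_differentiable hτ z) (theta_ne_zero hτ hz)

theorem tendsto_id_div_theta {τ : ℂ} (hτ : 0 < τ.im) :
    Tendsto (fun z => z / theta τ z) (𝓝[≠] 0) (𝓝 (deriv (theta τ) 0)⁻¹) :=
  tendsto_id_div_of_hasDerivAt (theta_differentiable hτ 0).hasDerivAt (theta_zero τ)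
    (deriv_theta_zero_ne_zero hτ)

theorem tendsto_mul_E1 {τ : ℂ} (hτ : 0 < τ.im) :
    Tendsto (fun z => z * E1 τ z) (𝓝[≠] 0) (𝓝 1) := by
  have h1 : Tendsto (deriv (theta τ)) (𝓝[≠] 0) (𝓝 (deriv (theta τ) 0)) :=
    ((deriv_theta_differentiable hτ).continuous.tendsto 0).mono_left nhdsWithin_le_nhds
  have h2 := h1.mul (tendsto_id_div_theta hτ)
  rw [mul_inv_cancel₀ (deriv_theta_zero_ne_zero hτ)] at h2
  refine h2.congr fun z => ?_
  rw [E1]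
  ring

theorem E2_add_one (τ z : ℂ) : E2 τ (z + 1) = E2 τ z := by
  rw [E2, E2, ← deriv_comp_add_const, funext (E1_add_one τ)]

theorem E2_neg (τ z : ℂ) : E2 τ (-z) = E2 τ z := by
  have := deriv_comp_neg (E1 τ) z
  rw [funext (E1_neg τ), deriv.fun_neg] at this
  rw [E2, E2, this]

theorem E2_add_tau {τ : ℂ} (hτ : 0 < τ.im) {z : ℂ} (hz : z ∉ lattice τ) :
    E2 τ (z + τ) = E2 τ z := by
  have : (fun z => E1 τ (z + τ)) =ᶠ[𝓝 z] fun z => E1 τ z - 2 * Real.pi * Complex.I := by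
    filter_upwards [(isOpen_compl_lattice hτ).mem_nhds hz] with w hw
    exact E1_add_tau hτ hw
  rw [E2, E2, ← deriv_comp_add_const, this.deriv_eq, deriv_sub_const]

theorem E2_differentiableAt {τ : ℂ} (hτ : 0 < τ.im) {z : ℂ} (hz : z ∉ lattice τ) :
    DifferentiableAt ℂ (E2 τ) z := by
  have : DifferentiableOn ℂ (E1 τ) (lattice τ)ᶜ := fun w hw =>
    (E1_differentiableAt hτ hw).differentiableWithinAt
  have h := this.deriv (isOpen_compl_lattice hτ)
  exact (h.differentiableAt ((isOpen_compl_lattice hτ).mem_nhds hz)).neg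

/-- The common denominator θ² exhibits the double pole at 0, so that it can be cancelled against a
product of two Kronecker functions. -/
theorem E2_eq {τ : ℂ} (hτ : 0 < τ.im) {z : ℂ} (hz : z ∉ lattice τ) :
    E2 τ z = (deriv (theta τ) z ^ 2 - deriv (deriv (theta τ)) z * theta τ z) / theta τ z ^ 2 := by
  have := ((deriv_theta_differentiable hτ z).hasDerivAt.div
    (theta_differentiable hτ z).hasDerivAt (theta_ne_zero hτ hz)).deriv
  have e : E1 τ = deriv (theta τ) / theta τ := rfl
  rw [E2, e, this]
  ring

/-! ### Doubly periodic functions with a simple pole, and quasi-periodic functions -/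

/-- A doubly periodic function with at most a simple pole per period cell has no pole and is
constant. -/
theorem residue_eq_zero_and_const {τ : ℂ} (hτ : 0 < τ.im) {f : ℂ → ℂ} {r : ℂ}
    (hf : DifferentiableOn ℂ f (lattice τ)ᶜ)
    (h1 : ∀ z ∉ lattice τ, f (z + 1) = f z) (h2 : ∀ z ∉ lattice τ, f (z + τ) = f z)
    (h0 : Tendsto (fun z => z * f z) (𝓝[≠] 0) (𝓝 r)) :
    r = 0 ∧ ∃ c, ∀ z ∉ lattice τ, f z = c := by
  -- Subtracting r E₁ removes the pole and leaves an entire F with F(z + 1) = F(z) and F(z + τ) =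
  -- F(z) + 2πi r. Its derivative is elliptic, hence constant, so F is affine. The period 1 makes
  -- the slope 0, which forces 2πi r = 0.
  have hr : r = 0 := by
    obtain ⟨F, hF, -, e1, e2⟩ := exists_entire_extension_of_affine_multipliers hτ
      (f := fun z => f z - r * E1 τ z) (a := 1) (b := 0) (a' := 1)
      (b' := 2 * Real.pi * Complex.I * r) one_ne_zero one_ne_zero
      (fun z hz => (hf z hz).sub
        (((E1_differentiableAt hτ hz).const_mul r).differentiableWithinAt))
      (fun z hz => by rw [h1 z hz, E1_add_one]; ring)
      (fun z hz => by rw [h2 z hz, E1_add_tau hτ hz]; ring)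
      (by
        have := h0.sub ((tendsto_mul_E1 hτ).const_mul r)
        rw [mul_one, sub_self] at this
        exact this.congr fun z => by ring)
    simp only [one_mul, add_zero] at e1 e2
    have d1 : ∀ z, deriv F (z + 1) = deriv F z := fun z => by
      rw [← deriv_comp_add_const, funext e1]
    have d2 : ∀ z, deriv F (z + τ) = deriv F z := fun z => by
      rw [← deriv_comp_add_const, funext e2, deriv_add_const]
    have hc : ∀ z, deriv F z = deriv F 0 := fun z =>
      apply_eq_of_doubly_periodic hτ hF.deriv d1 d2 z 0
    have hG : ∀ z, F z - deriv F 0 * z = F 0 - deriv F 0 * 0 := fun z => by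
      refine is_const_of_deriv_eq_zero (f := fun z => F z - deriv F 0 * z)
        (hF.sub (by fun_prop)) (fun w => ?_) z 0
      have := ((hF w).hasDerivAt.sub ((hasDerivAt_id w).const_mul (deriv F 0))).deriv
      simp only [mul_one, hc w, sub_self] at this
      exact this
    have g1 := hG 1
    have g2 := e1 0
    rw [zero_add] at g2
    have hd : deriv F 0 = 0 := by linear_combination g2 - g1
    have g3 := hG τ
    have g4 := e2 0
    rw [zero_add] at g4
    rw [hd] at g3
    have : 2 * Real.pi * Complex.I * r = 0 := by linear_combination g3 - g4
    exact (mul_eq_zero.1 this).resolve_left Complex.two_pi_I_ne_zero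
  subst hr
  exact ⟨rfl, exists_eq_const_of_doubly_periodic hτ hf h1 h2 h0⟩

/-- A function with constant multipliers and without poles vanishes if there is a function with the
inverse multipliers and with a simple pole. -/
theorem eq_zero_of_inverse_multipliers {τ : ℂ} (hτ : 0 < τ.im) {f χ : ℂ → ℂ} {a b : ℂ}
    (ha : a ≠ 0) (hb : b ≠ 0) (hf : DifferentiableOn ℂ f (lattice τ)ᶜ)
    (hχ : DifferentiableOn ℂ χ (lattice τ)ᶜ)
    (f1 : ∀ z ∉ lattice τ, f (z + 1) = a * f z) (f2 : ∀ z ∉ lattice τ, f (z + τ) = b * f z)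
    (c1 : ∀ z ∉ lattice τ, χ (z + 1) = a⁻¹ * χ z) (c2 : ∀ z ∉ lattice τ, χ (z + τ) = b⁻¹ * χ z)
    (f0 : Tendsto (fun z => z * f z) (𝓝[≠] 0) (𝓝 0))
    (c0 : Tendsto (fun z => z * χ z) (𝓝[≠] 0) (𝓝 1)) : ∀ z ∉ lattice τ, f z = 0 := by
  obtain ⟨F, hF, hFf, e1, e2⟩ := exists_entire_extension_of_affine_multipliers hτ ha hb (b := 0)
    (b' := 0) hf (by simpa using f1) (by simpa using f2) f0
  simp only [add_zero] at e1 e2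
  intro w hw
  rw [← hFf w hw]
  -- The product F(z + w) χ(z) is elliptic with a simple pole at 0 of residue F(w), and this residue
  -- must vanish.
  refine (residue_eq_zero_and_const hτ (f := fun z => F (z + w) * χ z) ?_ ?_ ?_ ?_).1
  · exact DifferentiableOn.mul (Differentiable.differentiableOn (by fun_prop)) hχ
  · intro z hz
    rw [c1 z hz, add_right_comm, e1]
    field_simp
  · intro z hz
    rw [c2 z hz, add_right_comm, e2]
    field_simp
  · have h1 : Tendsto (fun z => F (z + w)) (𝓝[≠] 0) (𝓝 (F (0 + w))) :=
      (Continuous.tendsto (by have := hF.continuous; fun_prop) 0).mono_left nhdsWithin_le_nhds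
    have h2 := h1.mul c0
    rw [zero_add, mul_one] at h2
    exact h2.congr fun z => by ring

/-! ### The Kronecker function -/

theorem kronecker_comm (τ x z : ℂ) : kronecker τ x z = kronecker τ z x := by
  rw [kronecker, kronecker, add_comm, mul_comm (theta τ x)]

theorem kronecker_add_one (τ x z : ℂ) : kronecker τ x (z + 1) = kronecker τ x z := by
  rw [kronecker, kronecker, ← add_assoc, theta_add_one, theta_add_one, neg_mul, mul_neg,
    neg_div_neg_eq]

theorem kronecker_add_tau (τ x z : ℂ) :
    kronecker τ x (z + τ) = ee (-x) * kronecker τ x z := by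
  rw [kronecker, kronecker, ← add_assoc, theta_add_tau, theta_add_tau]
  have e : Complex.exp (-(Real.pi * Complex.I * (τ + 2 * (x + z)))) =
      ee (-x) * Complex.exp (-(Real.pi * Complex.I * (τ + 2 * z))) := by
    unfold ee; rw [← Complex.exp_add]; ring_nf
  rw [e]
  have h := Complex.exp_ne_zero (-(Real.pi * Complex.I * (τ + 2 * z)))
  rw [show -(ee (-x) * Complex.exp (-(Real.pi * Complex.I * (τ + 2 * z)))) * theta τ (x + z) *
      deriv (theta τ) 0 = -Complex.exp (-(Real.pi * Complex.I * (τ + 2 * z))) *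
        (ee (-x) * (theta τ (x + z) * deriv (theta τ) 0)) by ring,
    show theta τ x * (-Complex.exp (-(Real.pi * Complex.I * (τ + 2 * z))) * theta τ z) =
      -Complex.exp (-(Real.pi * Complex.I * (τ + 2 * z))) * (theta τ x * theta τ z) by ring,
    mul_div_mul_left _ _ (neg_ne_zero.2 h), mul_div_assoc]

theorem kronecker_differentiableOn {τ : ℂ} (hτ : 0 < τ.im) {x : ℂ} (hx : x ∉ lattice τ) :
    DifferentiableOn ℂ (kronecker τ x) (lattice τ)ᶜ := by
  intro z hz
  have ht := theta_differentiable hτ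
  refine DifferentiableAt.differentiableWithinAt ?_
  unfold kronecker
  exact DifferentiableAt.div (by fun_prop) (by fun_prop)
    (mul_ne_zero (theta_ne_zero hτ hx) (theta_ne_zero hτ hz))

theorem tendsto_mul_kronecker {τ : ℂ} (hτ : 0 < τ.im) {x : ℂ} (hx : x ∉ lattice τ) :
    Tendsto (fun z => z * kronecker τ x z) (𝓝[≠] 0) (𝓝 1) := by
  have hc := (theta_differentiable hτ).continuous
  have h1 : Tendsto (fun z => theta τ (x + z) * deriv (theta τ) 0 / theta τ x) (𝓝[≠] 0)
      (𝓝 (theta τ (x + 0) * deriv (theta τ) 0 / theta τ x)) :=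
    (Continuous.tendsto (by fun_prop) 0).mono_left nhdsWithin_le_nhds
  have h2 := h1.mul (tendsto_id_div_theta hτ)
  have hd := deriv_theta_zero_ne_zero hτ
  have hx0 := theta_ne_zero hτ hx
  rw [add_zero, mul_div_cancel_left₀ _ hx0, mul_inv_cancel₀ hd] at h2
  refine h2.congr fun z => ?_
  rw [kronecker]
  ring

theorem tendsto_mul_ee_mul_kronecker {τ : ℂ} (hτ : 0 < τ.im) (β : ℂ) {y : ℂ}
    (hy : y ∉ lattice τ) :
    Tendsto (fun z => z * (ee (β * z) * kronecker τ y z)) (𝓝[≠] 0) (𝓝 1) := by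
  have hc := ee_differentiable.continuous
  have h1 : Tendsto (fun z => ee (β * z)) (𝓝[≠] 0) (𝓝 (ee (β * 0))) :=
    (Continuous.tendsto (by fun_prop) 0).mono_left nhdsWithin_le_nhds
  have h2 := h1.mul (tendsto_mul_kronecker hτ hy)
  rw [mul_zero, ee_zero, mul_one] at h2
  exact h2.congr fun z => by ring

theorem ee_mul_kronecker_differentiableOn {τ : ℂ} (hτ : 0 < τ.im) (β : ℂ) {y : ℂ}
    (hy : y ∉ lattice τ) :
    DifferentiableOn ℂ (fun z => ee (β * z) * kronecker τ y z) (lattice τ)ᶜ := by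
  have := ee_differentiable
  exact DifferentiableOn.mul (Differentiable.differentiableOn (by fun_prop))
    (kronecker_differentiableOn hτ hy)

theorem ee_mul_kronecker_add_one (τ β y z : ℂ) :
    ee (β * (z + 1)) * kronecker τ y (z + 1) = ee β * (ee (β * z) * kronecker τ y z) := by
  rw [kronecker_add_one, mul_add, mul_one, ee_add]
  ring

theorem ee_mul_kronecker_add_tau (τ β y z : ℂ) : ee (β * (z + τ)) * kronecker τ y (z + τ) =
    ee (β * τ - y) * (ee (β * z) * kronecker τ y z) := by
  rw [kronecker_add_tau, mul_add, sub_eq_add_neg, ee_add, ee_add]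
  ring

/-- A function with the multipliers of `𝐞(β z) φ(y, z)` and at most a simple pole is a multiple of
`𝐞(β z) φ(y, z)`. -/
theorem eq_mul_ee_mul_kronecker {τ : ℂ} (hτ : 0 < τ.im) {β y s : ℂ} (hy : y ∉ lattice τ)
    {f : ℂ → ℂ} (hf : DifferentiableOn ℂ f (lattice τ)ᶜ)
    (h1 : ∀ z ∉ lattice τ, f (z + 1) = ee β * f z)
    (h2 : ∀ z ∉ lattice τ, f (z + τ) = ee (β * τ - y) * f z)
    (h0 : Tendsto (fun z => z * f z) (𝓝[≠] 0) (𝓝 s)) :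
    ∀ z ∉ lattice τ, f z = s * (ee (β * z) * kronecker τ y z) := by
  have hy' : -y ∉ lattice τ := fun h => hy (neg_mem_lattice.1 h)
  have hd := ee_mul_kronecker_differentiableOn hτ β hy
  -- The difference of the two sides has no pole at 0. Changing the signs of β and y inverts both
  -- multipliers, which supplies the auxiliary function with a simple pole.
  have := eq_zero_of_inverse_multipliers hτ
    (f := fun z => f z - s * (ee (β * z) * kronecker τ y z))
    (χ := fun z => ee (-β * z) * kronecker τ (-y) z) (a := ee β) (b := ee (β * τ - y))
    (ee_ne_zero _) (ee_ne_zero _) (hf.sub (hd.const_mul s))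
    (ee_mul_kronecker_differentiableOn hτ _ hy')
    (fun z hz => by rw [h1 z hz, ee_mul_kronecker_add_one]; ring)
    (fun z hz => by rw [h2 z hz, ee_mul_kronecker_add_tau]; ring)
    (fun z _ => by rw [ee_mul_kronecker_add_one, ee_neg])
    (fun z _ => by rw [ee_mul_kronecker_add_tau, ← ee_neg]; ring_nf)
    (by
      have := h0.sub ((tendsto_mul_ee_mul_kronecker hτ β hy).const_mul s)
      rw [mul_one, sub_self] at this
      exact this.congr fun z => by ring)
    (tendsto_mul_ee_mul_kronecker hτ _ hy')
  exact fun z hz => sub_eq_zero.1 (this z hz)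

/-- `φ(x, z) φ(-x, z) = E₂(z) - E₂(x)`. -/
theorem kronecker_mul_kronecker_neg {τ : ℂ} (hτ : 0 < τ.im) {x z : ℂ} (hx : x ∉ lattice τ)
    (hz : z ∉ lattice τ) : kronecker τ x z * kronecker τ (-x) z = E2 τ z - E2 τ x := by
  have hx' : -x ∉ lattice τ := fun h => hx (neg_mem_lattice.1 h)
  have ht := theta_differentiable hτ
  have ht' := deriv_theta_differentiable hτ
  have ht'' : Differentiable ℂ (deriv (deriv (theta τ))) := ht'.deriv
  have hx0 := theta_ne_zero hτ hx
  -- N is the numerator of φ(x,z) φ(-x,z) - E₂(z) over θ(z)². Since N(0) = 0, the double poles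
  -- cancel and at most a simple pole is left; an elliptic function of this kind is constant.
  let N : ℂ → ℂ := fun z => -(theta τ (x + z) * theta τ (-x + z) * deriv (theta τ) 0 ^ 2 /
    theta τ x ^ 2) - (deriv (theta τ) z ^ 2 - deriv (deriv (theta τ)) z * theta τ z)
  have hN : Differentiable ℂ N := by fun_prop
  have hN0 : N 0 = 0 := by
    simp only [N, add_zero, theta_neg, theta_zero]
    field_simp
    ring
  have hlim : Tendsto (fun z => z * (kronecker τ x z * kronecker τ (-x) z - E2 τ z)) (𝓝[≠] 0)
      (𝓝 (deriv N 0 * ((deriv (theta τ) 0)⁻¹ * (deriv (theta τ) 0)⁻¹))) := by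
    refine ((tendsto_div_of_hasDerivAt (hN 0).hasDerivAt hN0).mul
      ((tendsto_id_div_theta hτ).mul (tendsto_id_div_theta hτ))).congr' ?_
    filter_upwards [eventually_notMem_lattice hτ 0] with w hw
    have h1 := ne_zero_of_notMem_lattice hw
    have h2 := theta_ne_zero hτ hw
    rw [E2_eq hτ hw, kronecker, kronecker, theta_neg τ x]
    simp only [N]
    field_simp
  obtain ⟨-, c, hc⟩ := residue_eq_zero_and_const hτ
    (f := fun z => kronecker τ x z * kronecker τ (-x) z - E2 τ z)
    (((kronecker_differentiableOn hτ hx).mul (kronecker_differentiableOn hτ hx')).sub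
      fun w hw => (E2_differentiableAt hτ hw).differentiableWithinAt)
    (fun w _ => by rw [kronecker_add_one, kronecker_add_one, E2_add_one])
    (fun w hw => by
      rw [kronecker_add_tau, kronecker_add_tau, E2_add_tau hτ hw, ee_neg (-x)]
      have := ee_ne_zero (-x)
      field_simp)
    hlim
  -- The constant is found at z = x, where φ(-x, x) = 0 because θ(0) = 0.
  have h1 := hc x hx
  have h2 := hc z hz
  have h3 : kronecker τ (-x) x = 0 := by
    rw [kronecker, neg_add_cancel, theta_zero, zero_mul, zero_div]
  rw [h3] at h1
  linear_combination h2 - h1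

/-! ### The graded basis -/

theorem fin_two_eq (a : Fin 2) : a = 0 ∨ a = 1 := by fin_cases a <;> simp

theorem sgn_mul_self (α a b : Fin 2) : sgn α a b * sgn α a b = 1 := by
  rcases fin_two_eq b with rfl | rfl <;> by_cases h : α = 0 ∧ a = 0 <;> simp [sgn, h]

theorem trace_fromBlocks_eq {m : Type*} [Fintype m] (A B C D : Matrix m m ℂ) :
    (Matrix.fromBlocks A B C D).trace = A.trace + D.trace := by
  simp [Matrix.trace, Fintype.sum_sum_type]

theorem trace_mul_T {n : ℕ} (R : Mat n) (α a b : Fin 2) (j k : Fin n) :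
    (R * T α a b j k).trace =
      pauli α a 0 0 * (R (.inl k) (.inl j) + sgn α a b * R (.inl j.rev) (.inl k.rev)) +
      pauli α a 1 0 * (R (.inl k) (.inr j) + sgn α a b * R (.inl j.rev) (.inr k.rev)) +
      pauli α a 0 1 * (R (.inr k) (.inl j) + sgn α a b * R (.inr j.rev) (.inl k.rev)) +
      pauli α a 1 1 * (R (.inr k) (.inr j) + sgn α a b * R (.inr j.rev) (.inr k.rev)) := by
  conv_lhs => rw [← Matrix.fromBlocks_toBlocks R]
  simp only [T, Matrix.fromBlocks_multiply, trace_fromBlocks_eq, Matrix.trace_add,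
    Matrix.mul_smul, Matrix.mul_add, Matrix.trace_smul, Matrix.trace_mul_single, smul_eq_mul,
    Matrix.toBlocks₁₁, Matrix.toBlocks₁₂, Matrix.toBlocks₂₁, Matrix.toBlocks₂₂, Matrix.of_apply,
    MulOpposite.op_one, one_smul]
  ring

/-- Reflection in the antidiagonal exchanges the two matrix units of a generator. This is why the
index pairs in `pairs` suffice. -/
theorem T_rev {n : ℕ} (α a b : Fin 2) (j k : Fin n) :
    T α a b k.rev j.rev = sgn α a b • T α a b j k := by
  have h : (Matrix.single k.rev j.rev (1 : ℂ) + sgn α a b • Matrix.single j.rev.rev k.rev.rev 1 :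
      Matrix (Fin n) (Fin n) ℂ) =
      sgn α a b • (Matrix.single j k 1 + sgn α a b • Matrix.single k.rev j.rev 1) := by
    rw [Fin.rev_rev, Fin.rev_rev, smul_add, smul_smul, sgn_mul_self, one_smul, add_comm]
  simp only [T]
  rw [h, Matrix.fromBlocks_smul]
  simp only [smul_comm (sgn α a b)]

/-- The indicator of the non-zero generators. -/
noncomputable def support {n : ℕ} (α a b : Fin 2) (j k : Fin n) : ℂ :=
  if k = j.rev ∧ sgn α a b = -1 then 0 else 1

theorem T_eq_zero {n : ℕ} {α a b : Fin 2} {j k : Fin n} (h : k = j.rev ∧ sgn α a b = -1) :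
    T α a b j k = 0 := by
  obtain ⟨rfl, hs⟩ := h
  simp [T, hs]

theorem support_smul_T {n : ℕ} (α a b : Fin 2) (j k : Fin n) :
    support α a b j k • T α a b j k = T α a b j k := by
  unfold support
  split_ifs with h
  · rw [T_eq_zero h, smul_zero]
  · rw [one_smul]

theorem eq_rev_comm {n : ℕ} {j k : Fin n} : j = k.rev ↔ k = j.rev := by
  constructor <;> rintro rfl <;> simp

theorem support_comm {n : ℕ} (α a b : Fin 2) (j k : Fin n) :
    support α a b k j = support α a b j k := by
  unfold support
  simp only [eq_rev_comm]

theorem normT_comm {n : ℕ} (j k : Fin n) : normT k j = normT j k := by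
  unfold normT
  simp only [eq_rev_comm]

theorem normT_ne_zero {n : ℕ} (j k : Fin n) : normT j k ≠ 0 := by
  unfold normT; split_ifs <;> norm_num

theorem support_mul_coord {n : ℕ} (S : Mat n) (α a b : Fin 2) (j k : Fin n) :
    support α a b j k * coord S α a b j k = coord S α a b j k := by
  rw [coord, ← support_smul_T α a b k j, support_comm α a b j k]
  unfold support
  split_ifs <;> simp

theorem sgn_eq_one_or (α a b : Fin 2) : sgn α a b = 1 ∨ sgn α a b = -1 :=
  mul_self_eq_one_iff.1 (sgn_mul_self α a b)

theorem mem_pairs {n : ℕ} {p : Fin n × Fin n} : p ∈ pairs n ↔ p.1.val + p.2.val < n := by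
  simp [pairs]

theorem pauli_eq (α a : Fin 2) : pauli α a =
    if a = 0 then (if α = 0 then 1 else !![0, 1; 1, 0])
      else (if α = 0 then !![1, 0; 0, -1] else !![0, -Complex.I; Complex.I, 0]) := by
  rcases fin_two_eq α with rfl | rfl <;> rcases fin_two_eq a with rfl | rfl <;> rfl

theorem trace_pauli_mul_pauli (α a α' a' : Fin 2) : (pauli α a * pauli α' a').trace =
    if α' = α ∧ a' = a then 2 else 0 := by
  rcases fin_two_eq α with rfl | rfl <;> rcases fin_two_eq a with rfl | rfl <;>
  rcases fin_two_eq α' with rfl | rfl <;> rcases fin_two_eq a' with rfl | rfl <;>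
  simp [pauli_eq, Matrix.trace_fin_two] <;> norm_num

theorem trace_single_mul_single {n : ℕ} (j k j' k' : Fin n) :
    (Matrix.single j k (1 : ℂ) * Matrix.single j' k' 1).trace =
      if j' = k ∧ k' = j then 1 else 0 := by
  rw [Matrix.trace_mul_single, MulOpposite.op_one, one_smul, Matrix.single_apply]
  simp only [eq_comm, and_comm]

theorem trace_symm_single_mul {n : ℕ} (ε ε' : ℂ) (j k j' k' : Fin n) :
    ((Matrix.single j k (1 : ℂ) + ε • Matrix.single k.rev j.rev 1) *
      (Matrix.single j' k' (1 : ℂ) + ε' • Matrix.single k'.rev j'.rev 1)).trace =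
    (1 + ε * ε') * (if j' = k ∧ k' = j then 1 else 0) +
      (ε + ε') * (if j' = j.rev ∧ k' = k.rev then 1 else 0) := by
  simp only [add_mul, mul_add, Matrix.smul_mul, Matrix.mul_smul, Matrix.trace_add,
    Matrix.trace_smul, trace_single_mul_single, smul_eq_mul, Fin.rev_eq_iff]
  simp only [Fin.rev_rev, and_comm]
  ring

theorem trace_T_mul_T {n : ℕ} (α a b α' a' b' : Fin 2) (j k j' k' : Fin n) :
    (T α a b j k * T α' a' b' j' k').trace = (pauli α a * pauli α' a').trace *
      ((Matrix.single j k (1 : ℂ) + sgn α a b • Matrix.single k.rev j.rev 1) *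
      (Matrix.single j' k' (1 : ℂ) + sgn α' a' b' • Matrix.single k'.rev j'.rev 1)).trace := by
  simp only [T]
  generalize (Matrix.single j k (1 : ℂ) + sgn α a b • Matrix.single k.rev j.rev 1) = X
  generalize (Matrix.single j' k' (1 : ℂ) + sgn α' a' b' • Matrix.single k'.rev j'.rev 1) = Y
  simp only [Matrix.fromBlocks_multiply, trace_fromBlocks_eq, Matrix.trace_add,
    Matrix.mul_smul, Matrix.smul_mul, Matrix.trace_smul, smul_eq_mul, Matrix.trace_fin_two,
    Matrix.mul_apply, Fin.sum_univ_two]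
  ring

/-- The generators with indices in `pairs n` are dual to each other under the trace form. -/
theorem trace_T_mul_T_pairs {n : ℕ} {α a b α' a' b' : Fin 2} {p p' : Fin n × Fin n}
    (hp : p ∈ pairs n) (hp' : p' ∈ pairs n) :
    (T α' a' b' p'.1 p'.2 * T α a b p.2 p.1).trace =
      if α' = α then if a' = a then if b' = b then if p' = p then
        normT p.1 p.2 * support α a b p.1 p.2 else 0 else 0 else 0 else 0 := by
  rw [trace_T_mul_T, trace_pauli_mul_pauli, trace_symm_single_mul]
  rw [mem_pairs] at hp hp'
  obtain ⟨j, k⟩ := p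
  obtain ⟨j', k'⟩ := p'
  simp only at hp hp' ⊢
  by_cases hα : α' = α
  swap
  · rw [if_neg hα, if_neg (fun h => hα h.1.symm), zero_mul]
  by_cases ha : a' = a
  swap
  · rw [if_pos hα, if_neg ha, if_neg (fun h => ha h.2.symm), zero_mul]
  subst hα ha
  rw [if_pos ⟨rfl, rfl⟩, if_pos rfl, if_pos rfl]
  by_cases hb : b' = b
  swap
  -- Different b give opposite signs ε' = -ε, so both coefficients 1 + εε' and ε + ε' vanish.
  · have : sgn α' a' b' = -sgn α' a' b := by
      rcases fin_two_eq b with rfl | rfl <;> rcases fin_two_eq b' with rfl | rfl <;>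
        simp [sgn] at hb ⊢ <;> split_ifs <;> simp
    rw [if_neg hb, this]
    have h1 := sgn_mul_self α' a' b
    rw [show (1 + -sgn α' a' b * sgn α' a' b) = 0 by linear_combination -h1, neg_add_cancel]
    ring
  subst hb
  rw [if_pos rfl, sgn_mul_self]
  -- Both pairs lie on or above the antidiagonal, and reflection exchanges its two sides. A match
  -- through reflection is therefore possible only on the antidiagonal, where it fixes the pair.
  have e : (k = j'.rev ∧ j = k'.rev) ↔ (j', k') = (j, k) ∧ k = j.rev := by
    rw [Prod.mk.injEq]
    constructor
    · rintro ⟨rfl, rfl⟩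
      simp only [Fin.val_rev] at hp
      have h1 : j'.val + k'.val + 1 = n := by omega
      refine ⟨⟨?_, ?_⟩, ?_⟩ <;> ext <;> simp only [Fin.val_rev] <;> omega
    · rintro ⟨⟨rfl, rfl⟩, rfl⟩
      simp
  have e' : (k = k' ∧ j = j') ↔ (j', k') = (j, k) := by
    rw [Prod.mk.injEq, eq_comm, and_comm, @eq_comm _ j]
  simp only [e, e']
  by_cases h : (j', k') = (j, k)
  · rw [if_pos h, if_pos h]
    -- Off the antidiagonal only the direct match counts and the trace is 2 · 2 = 4. On it both
    -- matches count and the trace is 2(2 + 2ε), which is 8 or 0; the value 0 occurs exactly for the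
    -- zero generators.
    unfold normT support
    by_cases hk : k = j.rev
    · rcases sgn_eq_one_or α' a' b' with hs | hs
      · have : ¬ (1 : ℂ) = -1 := by norm_num
        simp [h, hk, hs, this]; norm_num
      · simp [h, hk, hs]
    · simp [h, hk]; norm_num
  · simp [h]

/-! ### Linear combinations of the basis -/

/-- The linear combination of the basis with the given coefficients. -/
noncomputable def combination {n : ℕ} (c : Fin 2 → Fin 2 → Fin 2 → Fin n × Fin n → ℂ) : Mat n :=
  ∑ α, ∑ a, ∑ b, ∑ p ∈ pairs n, c α a b p • T α a b p.1 p.2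

theorem trace_combination_mul {n : ℕ} (c : Fin 2 → Fin 2 → Fin 2 → Fin n × Fin n → ℂ)
    (X : Mat n) : (combination c * X).trace =
      ∑ α, ∑ a, ∑ b, ∑ p ∈ pairs n, c α a b p * (T α a b p.1 p.2 * X).trace := by
  simp only [combination, Matrix.sum_mul, Matrix.trace_sum, Matrix.smul_mul, Matrix.trace_smul,
    smul_eq_mul]

/-- Follows from duality. The factor `support` is unavoidable, since the coefficient of a zero
generator leaves no trace in the matrix. -/
theorem coord_combination {n : ℕ} (c : Fin 2 → Fin 2 → Fin 2 → Fin n × Fin n → ℂ)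
    (α a b : Fin 2) {p : Fin n × Fin n} (hp : p ∈ pairs n) :
    coord (combination c) α a b p.1 p.2 = support α a b p.1 p.2 * c α a b p := by
  rw [coord, trace_combination_mul, div_eq_iff (normT_ne_zero _ _)]
  have h : ∀ α' a' b', ∑ p' ∈ pairs n, c α' a' b' p' *
      (T α' a' b' p'.1 p'.2 * T α a b p.2 p.1).trace =
      if α' = α then if a' = a then if b' = b then
        c α a b p * (normT p.1 p.2 * support α a b p.1 p.2) else 0 else 0 else 0 := by
    intro α' a' b'
    rw [Finset.sum_congr rfl fun p' hp' => by rw [trace_T_mul_T_pairs hp hp']]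
    split_ifs with h1 h2 h3
    · subst h1 h2 h3
      simp [hp]
    all_goals simp
  simp only [h, Finset.sum_ite_eq', Finset.mem_univ, if_true, Finset.sum_ite_irrel,
    Finset.sum_const_zero]
  ring

theorem coord_sub {n : ℕ} (R S : Mat n) (α a b : Fin 2) (j k : Fin n) :
    coord (R - S) α a b j k = coord R α a b j k - coord S α a b j k := by
  simp only [coord, Matrix.sub_mul, Matrix.trace_sub, sub_div]

/-- Adding the generators with b = 0 and b = 1 cancels the reflected matrix unit and leaves a
multiple of σ ⊗ E_jk. The four matrices σ span all 2 × 2 matrices, so every entry of R is recovered.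
-/
theorem eq_zero_of_trace_mul_T {n : ℕ} {R : Mat n}
    (h : ∀ α a b (j k : Fin n), (R * T α a b j k).trace = 0) : R = 0 := by
  have key : ∀ j k : Fin n, R (.inl k) (.inl j) = 0 ∧ R (.inl k) (.inr j) = 0 ∧
      R (.inr k) (.inl j) = 0 ∧ R (.inr k) (.inr j) = 0 := by
    intro j k
    have h1 := fun α a b => h α a b j k
    simp only [trace_mul_T] at h1
    have h000 := h1 0 0 0
    have h001 := h1 0 0 1
    have h010 := h1 0 1 0
    have h011 := h1 0 1 1
    have h100 := h1 1 0 0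
    have h101 := h1 1 0 1
    have h110 := h1 1 1 0
    have h111 := h1 1 1 1
    simp [pauli_eq, sgn] at h000 h001 h010 h011 h100 h101 h110 h111
    have hI : Complex.I * Complex.I = -1 := Complex.I_mul_I
    refine ⟨?_, ?_, ?_, ?_⟩
    · linear_combination (h000 + h001 + h010 + h011) / 4
    · linear_combination (h100 + h101 - Complex.I * (h110 + h111)) / 4 +
        (R (.inl k) (.inr j) - R (.inr k) (.inl j)) / 2 * hI
    · linear_combination (h100 + h101 + Complex.I * (h110 + h111)) / 4 -
        (R (.inl k) (.inr j) - R (.inr k) (.inl j)) / 2 * hI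
    · linear_combination (h000 + h001 - h010 - h011) / 4
  ext (p | p) (q | q)
  · exact (key q p).1
  · exact (key q p).2.1
  · exact (key q p).2.2.1
  · exact (key q p).2.2.2

/-- The graded basis spans. -/
theorem eq_combination_coord {n : ℕ} (S : Mat n) :
    S = combination fun α a b p => coord S α a b p.1 p.2 := by
  rw [← sub_eq_zero]
  set R := S - combination fun α a b p => coord S α a b p.1 p.2 with hR
  have h : ∀ α a b (j k : Fin n), (j, k) ∈ pairs n → (R * T α a b k j).trace = 0 := by
    intro α a b j k hp
    have h1 : coord R α a b j k = 0 := by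
      have := coord_combination (fun α a b p => coord S α a b p.1 p.2) α a b hp
      simp only [support_mul_coord] at this
      rw [hR, coord_sub, this, sub_self]
    rw [coord, div_eq_zero_iff] at h1
    exact h1.resolve_right (normT_ne_zero _ _)
  refine eq_zero_of_trace_mul_T fun α a b j k => ?_
  by_cases hp : (k, j) ∈ pairs n
  · exact h α a b k j hp
  -- Index pairs below the antidiagonal are reflected above it by `T_rev`.
  · have hp' : (j.rev, k.rev) ∈ pairs n := by
      rw [mem_pairs] at hp ⊢
      simp only [Fin.val_rev] at hp ⊢
      omega
    have h1 := h α a b _ _ hp'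
    rw [T_rev, Matrix.mul_smul, Matrix.trace_smul, smul_eq_mul] at h1
    refine (mul_eq_zero.1 h1).resolve_left ?_
    rcases sgn_eq_one_or α a b with hs | hs <;> rw [hs] <;> norm_num

theorem combination_eq_iff {n : ℕ} {c d : Fin 2 → Fin 2 → Fin 2 → Fin n × Fin n → ℂ}
    (h : combination c = combination d) (α a b : Fin 2) {p : Fin n × Fin n} (hp : p ∈ pairs n) :
    support α a b p.1 p.2 * c α a b p = support α a b p.1 p.2 * d α a b p := by
  rw [← coord_combination c α a b hp, h, coord_combination d α a b hp]

/-- Duality leaves no cross terms: the coefficient at jk meets only the one at kj in the same graded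
piece. -/
theorem trace_combination_sq {n : ℕ} (c : Fin 2 → Fin 2 → Fin 2 → Fin n × Fin n → ℂ) :
    (combination c ^ 2).trace = ∑ α, ∑ a, ∑ b, ∑ p ∈ pairs n,
      normT p.1 p.2 * support α a b p.1 p.2 * (c α a b p * c α a b p.swap) := by
  rw [sq, trace_combination_mul]
  refine Finset.sum_congr rfl fun α _ => Finset.sum_congr rfl fun a _ =>
    Finset.sum_congr rfl fun b _ => Finset.sum_congr rfl fun p hp => ?_
  have hp' : p.swap ∈ pairs n := by
    rw [mem_pairs] at hp ⊢
    simp only [Prod.fst_swap, Prod.snd_swap]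
    omega
  have h := coord_combination c α a b hp'
  rw [coord, div_eq_iff (normT_ne_zero _ _), Matrix.trace_mul_comm] at h
  simp only [Prod.fst_swap, Prod.snd_swap] at h
  rw [h, support_comm, normT_comm]
  ring

/-! ### The transition automorphisms on the basis -/

/-- `ν` as a linear map. -/
noncomputable def nuLinear (n : ℕ) : Mat n →ₗ[ℂ] Mat n where
  toFun := nu
  map_add' x y := by
    ext (p | p) (q | q) <;>
      simp [nu, tilde, Matrix.toBlocks₁₁, Matrix.toBlocks₁₂, Matrix.toBlocks₂₁, Matrix.toBlocks₂₂]
        <;> ring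
  map_smul' r x := by
    ext (p | p) (q | q) <;>
      simp [nu, tilde, Matrix.toBlocks₁₁, Matrix.toBlocks₁₂, Matrix.toBlocks₂₁, Matrix.toBlocks₂₂]

/-- The operation `tilde` takes E_jk to the matrix unit with indices reversed and exchanged, so it
swaps the two summands; ε² = 1 then turns the swap into the factor ε. -/
theorem tilde_symm_single {n : ℕ} (j k : Fin n) (r ε : ℂ) (hε : ε * ε = 1) :
    tilde (r • (Matrix.single j k 1 + ε • Matrix.single k.rev j.rev 1)) =
      (ε * r) • (Matrix.single j k 1 + ε • Matrix.single k.rev j.rev 1) := by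
  ext p q
  simp only [tilde, Matrix.of_apply, Matrix.smul_apply, Matrix.add_apply, Matrix.single_apply,
    smul_eq_mul, Fin.rev_inj]
  have e1 : (j = q.rev ∧ k = p.rev) ↔ (k.rev = p ∧ j.rev = q) := by
    constructor <;> rintro ⟨rfl, rfl⟩ <;> simp
  have e2 : (k = q ∧ j = p) ↔ (j = p ∧ k = q) := and_comm
  simp only [e1, e2]
  linear_combination (-r * (if k.rev = p ∧ j.rev = q then 1 else 0)) * hε

/-- The map `nu` combines `tilde`, which contributes `sgn`, with (A, B; C, D) ↦ (-D, B; C, -A),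
which negates σ₀ and fixes σ₁, σ₂, σ₃. This accounts for the exceptional sign of σ₀ in `sgn`. -/
theorem nu_T {n : ℕ} (α a b : Fin 2) (j k : Fin n) :
    nu (T α a b j k) = (-1 : ℂ) ^ (b : ℕ) • T α a b j k := by
  have hs := sgn_mul_self α a b
  simp only [nu, T, Matrix.toBlocks_fromBlocks₁₁, Matrix.toBlocks_fromBlocks₁₂,
    Matrix.toBlocks_fromBlocks₂₁, Matrix.toBlocks_fromBlocks₂₂, tilde_symm_single _ _ _ _ hs,
    Matrix.fromBlocks_smul, smul_smul, ← neg_smul]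
  congr 2 <;>
  · rcases fin_two_eq α with rfl | rfl <;> rcases fin_two_eq a with rfl | rfl <;>
      simp [pauli_eq, sgn]

theorem nu_combination {n : ℕ} (c : Fin 2 → Fin 2 → Fin 2 → Fin n × Fin n → ℂ) :
    nu (combination c) = combination fun α a b p => (-1 : ℂ) ^ (b : ℕ) * c α a b p := by
  change nuLinear n _ = _
  simp only [combination, map_sum, map_smul]
  refine Finset.sum_congr rfl fun α _ => Finset.sum_congr rfl fun a _ =>
    Finset.sum_congr rfl fun b _ => Finset.sum_congr rfl fun p _ => ?_
  change _ • nu _ = _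
  rw [nu_T, smul_smul, mul_comm]

theorem hatU_rev {n : ℕ} (u : Fin (n / 2) → ℂ) (j : Fin n) : hatU u j.rev = -hatU u j := by
  unfold hatU
  by_cases h : j.val < n / 2
  · have h1 : ¬ j.rev.val < n / 2 := by rw [Fin.val_rev]; omega
    have h2 : j.rev.rev.val < n / 2 := by rwa [Fin.rev_rev]
    rw [dif_neg h1, dif_pos h2, dif_pos h]
    simp
  · by_cases h1 : j.rev.val < n / 2
    · rw [dif_pos h1, dif_neg h, dif_pos h1, neg_neg]
    · have h2 : ¬ j.rev.rev.val < n / 2 := by rwa [Fin.rev_rev]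
      rw [dif_neg h1, dif_neg h2, dif_neg h, dif_neg h1, neg_zero]

theorem transitionMatrix_inv {n : ℕ} (u : Fin (n / 2) → ℂ) : (transitionMatrix u)⁻¹ = Lam n *
    Matrix.diagonal (Sum.elim (fun j => ee (-hatU u j)) (fun j => ee (-hatU u j))) := by
  refine Matrix.inv_eq_right_inv ?_
  have hL : Lam n * Lam n = 1 := by simp [Lam, Matrix.fromBlocks_multiply]
  rw [transitionMatrix, mul_assoc, ← mul_assoc (Lam n), hL, one_mul, Matrix.diagonal_mul_diagonal,
    ← Matrix.diagonal_one]
  congr 1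
  funext p
  rcases p with p | p <;> simp [ee_neg, ee_ne_zero]

/-- Conjugation by Λ fixes σ₀ and σ₁ and negates σ₂ and σ₃. Since û is odd under index reversal, the
two matrix units of a generator have the same weight û_j - û_k under the diagonal part. -/
theorem AdT_T {n : ℕ} (u : Fin (n / 2) → ℂ) (α a b : Fin 2) (j k : Fin n) :
    AdT u (T α a b j k) = ((-1) ^ (a : ℕ) * ee (hatU u j - hatU u k)) • T α a b j k := by
  set X : Matrix (Fin n) (Fin n) ℂ :=
    Matrix.single j k 1 + sgn α a b • Matrix.single k.rev j.rev 1 with hX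
  have hT : T α a b j k = Matrix.fromBlocks (pauli α a 0 0 • X) (pauli α a 0 1 • X)
    (pauli α a 1 0 • X) (pauli α a 1 1 • X) := rfl
  have hLTL : Lam n * T α a b j k * Lam n = (-1 : ℂ) ^ (a : ℕ) • T α a b j k := by
    rw [hT, Lam]
    simp only [Matrix.fromBlocks_multiply, zero_mul, mul_zero, one_mul, mul_one, zero_add,
      add_zero, Matrix.fromBlocks_smul, smul_smul]
    congr 2 <;>
    · rcases fin_two_eq α with rfl | rfl <;> rcases fin_two_eq a with rfl | rfl <;>
        simp [pauli_eq]
  have hXe : ∀ p q, ee (hatU u p) * X p q * ee (-hatU u q) =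
      ee (hatU u j - hatU u k) * X p q := by
    intro p q
    simp only [hX, Matrix.add_apply, Matrix.smul_apply, Matrix.single_apply, smul_eq_mul]
    have h1 : ee (hatU u p) * (if j = p ∧ k = q then (1 : ℂ) else 0) * ee (-hatU u q) =
        ee (hatU u j - hatU u k) * (if j = p ∧ k = q then 1 else 0) := by
      split_ifs with h
      · rw [← h.1, ← h.2, sub_eq_add_neg, ee_add]; ring
      · ring
    have h2 : ee (hatU u p) * (if k.rev = p ∧ j.rev = q then (1 : ℂ) else 0) * ee (-hatU u q) =
        ee (hatU u j - hatU u k) * (if k.rev = p ∧ j.rev = q then 1 else 0) := by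
      split_ifs with h
      · rw [← h.1, ← h.2, hatU_rev, hatU_rev, neg_neg, sub_eq_add_neg, ee_add]; ring
      · ring
    linear_combination h1 + sgn α a b * h2
  rw [AdT, transitionMatrix_inv, transitionMatrix,
    show ∀ D L Y D' : Mat n, D * L * Y * (L * D') = D * (L * Y * L) * D' by
      intros; simp only [mul_assoc], hLTL, Matrix.mul_smul, Matrix.smul_mul, mul_smul, hT]
  congr 1
  ext p q
  rw [Matrix.mul_diagonal, Matrix.diagonal_mul]
  rcases p with p | p <;> rcases q with q | q <;>
    simp only [Sum.elim_inl, Sum.elim_inr, Matrix.fromBlocks_apply₁₁, Matrix.fromBlocks_apply₁₂,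
      Matrix.fromBlocks_apply₂₁, Matrix.fromBlocks_apply₂₂, Matrix.smul_apply, smul_eq_mul]
  · linear_combination pauli α a 0 0 * hXe p q
  · linear_combination pauli α a 0 1 * hXe p q
  · linear_combination pauli α a 1 0 * hXe p q
  · linear_combination pauli α a 1 1 * hXe p q

theorem AdT_combination {n : ℕ} (u : Fin (n / 2) → ℂ)
    (c : Fin 2 → Fin 2 → Fin 2 → Fin n × Fin n → ℂ) :
    AdT u (combination c) = combination fun α a b p =>
      (-1) ^ (a : ℕ) * ee (hatU u p.1 - hatU u p.2) * c α a b p := by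
  unfold AdT combination
  simp only [Finset.mul_sum, Finset.sum_mul, Matrix.mul_smul, Matrix.smul_mul]
  refine Finset.sum_congr rfl fun α _ => Finset.sum_congr rfl fun a _ =>
    Finset.sum_congr rfl fun b _ => Finset.sum_congr rfl fun p _ => ?_
  change _ • AdT u _ = _
  rw [AdT_T, smul_smul, mul_comm]

/-! ### Sums over indices -/

theorem sum_castLE {M : Type*} [AddCommMonoid M] {m n : ℕ} (h : m ≤ n) (F : Fin n → M) :
    ∑ j : Fin m, F (Fin.castLE h j) = ∑ j : Fin n, if j.val < m then F j else 0 := by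
  rw [← Finset.sum_filter]
  refine Finset.sum_bij (fun j _ => Fin.castLE h j) ?_ ?_ ?_ ?_
  · intro j _
    simp
  · intro j _ k _ hjk
    exact Fin.castLE_injective h hjk
  · intro j hj
    exact ⟨⟨j.val, (Finset.mem_filter.1 hj).2⟩, Finset.mem_univ _, rfl⟩
  · intro j _
    rfl

theorem sum_pairs {M : Type*} [AddCommMonoid M] {n : ℕ} (F : Fin n → Fin n → M) :
    ∑ p ∈ pairs n, F p.1 p.2 = ∑ j, ∑ k, if j.val + k.val < n then F j k else 0 := by
  rw [pairs, Finset.sum_filter, Fintype.sum_prod_type]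

theorem sum_pairs_diag {M : Type*} [AddCommMonoid M] {n : ℕ} (F : Fin n → M) :
    ∑ p ∈ pairs n, (if p.1 = p.2 then F p.1 else 0) = ∑ j, F (lo' j) := by
  rw [sum_pairs (fun j k => if j = k then F j else 0)]
  unfold lo'
  rw [sum_castLE]
  refine Finset.sum_congr rfl fun j _ => ?_
  rw [Finset.sum_eq_single j]
  · rw [if_pos rfl]
    have : j.val + j.val < n ↔ j.val < (n + 1) / 2 := by omega
    simp only [this]
  · intro k _ hk
    rw [if_neg hk.symm, ite_self]
  · simp

theorem sum_lo'_eq_sum_lo {M : Type*} [AddCommMonoid M] {n : ℕ} (F : Fin n → M)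
    (hF : ∀ j : Fin n, ¬ j.val < n / 2 → F j = 0) :
    ∑ j : Fin ((n + 1) / 2), F (lo' j) = ∑ j : Fin (n / 2), F (lo j) := by
  unfold lo' lo
  rw [sum_castLE, sum_castLE]
  refine Finset.sum_congr rfl fun j _ => ?_
  by_cases h : j.val < n / 2
  · rw [if_pos h, if_pos (by omega)]
  · rw [if_neg h, hF j h, ite_self]

theorem sum_eq_lo_add_middle_add_rev {M : Type*} [AddCommMonoid M] {n : ℕ} (F : Fin n → M) :
    ∑ j, F j = ∑ j, F (lo j) + ∑ m ∈ middle n, F m + ∑ j : Fin (n / 2), F (lo j).rev := by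
  have h : ∑ j : Fin (n / 2), F (lo j).rev = ∑ j : Fin n, if j.rev.val < n / 2 then F j else 0 := by
    unfold lo
    rw [sum_castLE (Nat.div_le_self n 2) fun j => F j.rev,
      ← Equiv.sum_comp (Fin.revPerm (n := n)) fun j => if j.rev.val < n / 2 then F j else 0]
    simp
  rw [h, middle, Finset.sum_filter]
  unfold lo
  rw [sum_castLE, ← Finset.sum_add_distrib, ← Finset.sum_add_distrib]
  refine Finset.sum_congr rfl fun j _ => ?_
  have hm : j.rev = j ↔ ¬ j.val < n / 2 ∧ ¬ j.rev.val < n / 2 := by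
    rw [Fin.ext_iff, Fin.val_rev]; omega
  have h2 : j.val < n / 2 → ¬ j.rev.val < n / 2 := by
    rw [Fin.val_rev]; omega
  by_cases h1 : j.val < n / 2
  · rw [if_pos h1, if_neg (h2 h1), if_neg (fun h => (hm.1 h).1 h1), add_zero, add_zero]
  · by_cases h3 : j.rev.val < n / 2
    · rw [if_neg h1, if_pos h3, if_neg (fun h => (hm.1 h).2 h3), add_zero, zero_add]
    · rw [if_neg h1, if_neg h3, if_pos (hm.2 ⟨h1, h3⟩), add_zero, zero_add]

theorem sum_sum_symm {m : ℕ} (A : Fin m → Fin m → ℂ) (hA : ∀ j k, A j k = A k j) :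
    ∑ j, ∑ k, A j k = ∑ j, A j j + 2 * ∑ j, ∑ k with j < k, A j k := by
  have h1 : ∀ j k, A j k = (if j = k then A j k else 0) + (if j < k then A j k else 0) +
      (if k < j then A k j else 0) := by
    intro j k
    rcases lt_trichotomy j k with h | h | h
    · simp [h, h.ne, h.not_gt]
    · simp [h]
    · simp [h, h.ne', h.not_gt, hA j k]
  have h2 : ∑ j, ∑ k, (if k < j then A k j else 0) = ∑ j, ∑ k, if j < k then A j k else 0 :=
    Finset.sum_comm
  calc ∑ j, ∑ k, A j k = ∑ j, ∑ k, ((if j = k then A j k else 0) + (if j < k then A j k else 0) +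
        (if k < j then A k j else 0)) :=
      Finset.sum_congr rfl fun j _ => Finset.sum_congr rfl fun k _ => h1 j k
    _ = _ := by
      simp only [Finset.sum_add_distrib, h2, Finset.sum_filter, Finset.sum_ite_eq,
        Finset.mem_univ, if_true]
      ring

/-- The weight `normT`/8 is 1 on the antidiagonal and 1/2 above it. Indices are split into j ≤ l,
the middle index, and their reversals. Unordered off-diagonal pairs occur twice, which turns 1/2
into 1 and, on the antidiagonal, 1 into 2. Diagonal pairs jj occur once, with 1/2 for j ≤ l and 1
for the middle index. Reversed indices among themselves or with the middle one lie outside `pairs`.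
-/
theorem sum_pairs_symm {n : ℕ} (G : Fin n → Fin n → ℂ) (hG : ∀ j k, G j k = G k j) :
    ∑ p ∈ pairs n, normT p.1 p.2 / 8 * G p.1 p.2 =
      ((1 / 2) * ∑ j, G (lo j) (lo j) + ∑ m ∈ middle n, G m m) +
      (∑ j, ∑ k with j < k, (G (lo j) (lo k) + G (lo j) (lo k).rev)) +
      (∑ j, ∑ m ∈ middle n, G (lo j) m) + 2 * ∑ j, G (lo j) (lo j).rev := by
  have hlo : ∀ j : Fin (n / 2), (lo j : Fin n).val = j.val := fun j => rfl
  have hmid : ∀ m ∈ middle n, m.val + m.val + 1 = n := by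
    intro m hm
    have := congr_arg Fin.val (Finset.mem_filter.1 hm).2
    rw [Fin.val_rev] at this
    omega
  have key : ∀ j k : Fin n, (if j.val + k.val < n then normT j k / 8 * G j k else 0) =
      if j.val + k.val + 1 = n then G j k else if j.val + k.val + 1 < n then 1 / 2 * G j k
        else 0 := by
    intro j k
    have : k = j.rev ↔ j.val + k.val + 1 = n := by
      rw [Fin.ext_iff, Fin.val_rev]; omega
    unfold normT
    simp only [this]
    split_ifs <;> first | omega | ring
  rw [sum_pairs fun j k => normT j k / 8 * G j k]
  simp only [key]
  generalize hA : (fun j k : Fin n => if j.val + k.val + 1 = n then G j k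
    else if j.val + k.val + 1 < n then 1 / 2 * G j k else 0) = A
  have hA' : ∀ j k : Fin n, (if j.val + k.val + 1 = n then G j k
    else if j.val + k.val + 1 < n then 1 / 2 * G j k else 0) = A j k := fun j k => by rw [← hA]
  have hAs : ∀ j k, A j k = A k j := fun j k => by
    rw [← hA' j k, ← hA' k j, hG, add_comm j.val]
  simp only [hA']
  have ll : ∀ j k : Fin (n / 2), A (lo j) (lo k) = 1 / 2 * G (lo j) (lo k) := fun j k => by
    rw [← hA', hlo, hlo, if_neg (by omega), if_pos (by omega)]
  have lm : ∀ (j : Fin (n / 2)), ∀ m ∈ middle n, A (lo j) m = 1 / 2 * G (lo j) m :=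
    fun j m hm => by
      have := hmid m hm
      rw [← hA', hlo, if_neg (by omega), if_pos (by omega)]
  have mm : ∀ m ∈ middle n, ∀ m' ∈ middle n, A m m' = if m' = m then G m m else 0 :=
    fun m hm m' hm' => by
      have h1 := hmid m hm
      have h2 := hmid m' hm'
      have : m' = m := by ext; omega
      subst this
      rw [← hA', if_pos h1, if_pos rfl]
  have rm : ∀ (j : Fin (n / 2)), ∀ m ∈ middle n, A (lo j).rev m = 0 := fun j m hm => by
    have := hmid m hm
    rw [← hA', Fin.val_rev, hlo, if_neg (by omega), if_neg (by omega)]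
  have rr : ∀ j k : Fin (n / 2), A (lo j).rev (lo k).rev = 0 := fun j k => by
    rw [← hA', Fin.val_rev, hlo, Fin.val_rev, hlo, if_neg (by omega), if_neg (by omega)]
  have lr : ∀ j k : Fin (n / 2), A (lo j) (lo k).rev = (if j = k then G (lo j) (lo k).rev else 0) +
      (if j < k then 1 / 2 * G (lo j) (lo k).rev else 0) := fun j k => by
    rw [← hA', Fin.val_rev, hlo, hlo]
    rcases lt_trichotomy j k with h | h | h
    · rw [if_neg (by omega), if_pos (by omega), if_neg h.ne, if_pos h, zero_add]
    · rw [if_pos (by omega), if_pos h, if_neg h.not_lt, add_zero]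
    · rw [if_neg (by omega), if_neg (by omega), if_neg h.ne', if_neg h.not_gt, add_zero]
  have e1 : ∑ j : Fin (n / 2), ∑ k : Fin (n / 2), A (lo j) (lo k) =
      1 / 2 * ∑ j, G (lo j) (lo j) + ∑ j, ∑ k with j < k, G (lo j) (lo k) := by
    simp only [ll, ← Finset.mul_sum]
    rw [sum_sum_symm (fun j k : Fin (n / 2) => G (lo j) (lo k)) fun _ _ => hG _ _]
    ring
  have e2 : ∑ j : Fin (n / 2), ∑ m ∈ middle n, A (lo j) m =
      1 / 2 * ∑ j : Fin (n / 2), ∑ m ∈ middle n, G (lo j) m := by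
    simp only [Finset.mul_sum]
    exact Finset.sum_congr rfl fun j _ => Finset.sum_congr rfl fun m hm => lm j m hm
  have e3 : ∑ j : Fin (n / 2), ∑ k : Fin (n / 2), A (lo j) (lo k).rev =
      ∑ j, G (lo j) (lo j).rev + 1 / 2 * ∑ j, ∑ k with j < k, G (lo j) (lo k).rev := by
    simp only [lr, Finset.sum_add_distrib, Finset.sum_filter, Finset.mul_sum, mul_ite, mul_zero]
    simp
  have e4 : ∑ m ∈ middle n, ∑ j : Fin (n / 2), A m (lo j) =
      ∑ j : Fin (n / 2), ∑ m ∈ middle n, A (lo j) m := by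
    rw [Finset.sum_comm]
    simp only [hAs]
  have e5 : ∑ m ∈ middle n, ∑ m' ∈ middle n, A m m' = ∑ m ∈ middle n, G m m := by
    refine Finset.sum_congr rfl fun m hm => ?_
    rw [Finset.sum_congr rfl fun m' hm' => mm m hm m' hm', Finset.sum_ite_eq', if_pos hm]
  have e6 : ∑ m ∈ middle n, ∑ j : Fin (n / 2), A m (lo j).rev = 0 :=
    Finset.sum_eq_zero fun m hm => Finset.sum_eq_zero fun j _ => by rw [hAs, rm j m hm]
  have e7 : ∑ j : Fin (n / 2), ∑ k : Fin (n / 2), A (lo j).rev (lo k) =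
      ∑ j : Fin (n / 2), ∑ k : Fin (n / 2), A (lo j) (lo k).rev := by
    rw [Finset.sum_comm]
    exact Finset.sum_congr rfl fun j _ => Finset.sum_congr rfl fun k _ => hAs _ _
  have e8 : ∑ j : Fin (n / 2), ∑ m ∈ middle n, A (lo j).rev m = 0 :=
    Finset.sum_eq_zero fun j _ => Finset.sum_eq_zero fun m hm => rm j m hm
  rw [sum_eq_lo_add_middle_add_rev]
  simp only [sum_eq_lo_add_middle_add_rev (A _), Finset.sum_add_distrib, rr,
    Finset.sum_const_zero, add_zero]
  rw [e4, e5, e6, e7, e8, e1, e2, e3]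
  ring

/-! ### The coefficients of the Lax operator -/

/-- Extension of a vector by zero. -/
noncomputable def extendZero {m n : ℕ} (v : Fin m → ℂ) (j : Fin n) : ℂ :=
  if h : j.val < m then v ⟨j.val, h⟩ else 0

theorem extendZero_lo {n : ℕ} (v : Fin (n / 2) → ℂ) (j : Fin (n / 2)) :
    extendZero v (lo j) = v j := dif_pos j.isLt

theorem extendZero_lo' {n : ℕ} (w : Fin ((n + 1) / 2) → ℂ) (j : Fin ((n + 1) / 2)) :
    extendZero w (lo' j) = w j := dif_pos j.isLt

/-- The coefficients of the Lax operator in the graded basis. -/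
noncomputable def laxCoeff {n : ℕ} (τ : ℂ) (u v : Fin (n / 2) → ℂ) (w : Fin ((n + 1) / 2) → ℂ)
    (S : Mat n) (z : ℂ) (α a b : Fin 2) (p : Fin n × Fin n) : ℂ :=
  if a = 0 ∧ b = 0 ∧ p.1 = p.2 then
    (if α = 0 then extendZero v p.1 else extendZero w p.1)
  else coord S α a b p.1 p.2 * ee ((b : ℕ) * z / 2) *
    kronecker τ (-(hatU u p.1 - hatU u p.2) + halfPeriod τ a b) z

/-- Collecting all terms in one combination over the basis allows the rest to be argued
coefficientwise. Extending v by 0 to the middle index is harmless, as the generator there is zero.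
-/
theorem laxOperator_add_centralTerm {n : ℕ} (τ : ℂ) (u v : Fin (n / 2) → ℂ)
    (w : Fin ((n + 1) / 2) → ℂ) (S : Mat n) (z : ℂ) :
    laxOperator τ u v S z + centralTerm w = combination (laxCoeff τ u v w S z) := by
  have hsplit : ∀ α a b (p : Fin n × Fin n), laxCoeff τ u v w S z α a b p • T α a b p.1 p.2 =
      (if a = 0 then if b = 0 then if p.1 = p.2 then
        (if α = 0 then extendZero v p.1 else extendZero w p.1) • T α 0 0 p.1 p.1
        else 0 else 0 else 0) +
      if ¬(a = 0 ∧ b = 0 ∧ p.1 = p.2) then (coord S α a b p.1 p.2 * ee ((b : ℕ) * z / 2) *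
        kronecker τ (-(hatU u p.1 - hatU u p.2) + halfPeriod τ a b) z) • T α a b p.1 p.2
      else 0 := by
    intro α a b p
    unfold laxCoeff
    by_cases h : a = 0 ∧ b = 0 ∧ p.1 = p.2
    · obtain ⟨rfl, rfl, h⟩ := h
      simp [← h]
    · rw [if_neg h, if_pos h]
      by_cases ha : a = 0
      · by_cases hb : b = 0
        · simp [show ¬p.1 = p.2 from fun hp => h ⟨ha, hb, hp⟩]
        · simp [hb]
      · simp [ha]
  have hdiag : ∑ α : Fin 2, ∑ a : Fin 2, ∑ b : Fin 2, ∑ p ∈ pairs n,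
      (if a = 0 then if b = 0 then if p.1 = p.2 then
        (if α = 0 then extendZero v p.1 else extendZero w p.1) • T α 0 0 p.1 p.1
        else 0 else 0 else (0 : Mat n)) =
      ∑ j, v j • T 0 0 0 (lo j) (lo j) + centralTerm w := by
    simp only [Fin.sum_univ_two, if_true, one_ne_zero, if_false, Finset.sum_const_zero, add_zero]
    rw [sum_pairs_diag fun j : Fin n => extendZero v j • T 0 0 0 j j,
      sum_pairs_diag fun j : Fin n => extendZero w j • T 1 0 0 j j,
      sum_lo'_eq_sum_lo fun j : Fin n => extendZero v j • T 0 0 0 j j]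
    · simp only [extendZero_lo, extendZero_lo', centralTerm]
    · intro j hj
      rw [extendZero, dif_neg hj, zero_smul]
  simp only [combination, hsplit, Finset.sum_add_distrib, hdiag]
  rw [laxOperator]
  simp only [Finset.sum_filter]
  abel

/-! ### Lax operators -/

theorem ee_half (b : Fin 2) : ee (((b : ℕ) : ℂ) / 2) = (-1) ^ (b : ℕ) := by
  rcases fin_two_eq b with rfl | rfl
  · simp [ee_zero]
  · have : (2 * Real.pi * Complex.I * 2⁻¹ : ℂ) = Real.pi * Complex.I := by ring
    simp [ee, this, Complex.exp_pi_mul_I]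

/-- Otherwise 1 would be even: compare the coefficients of τ if b = 1, and the real parts if b = 0.
-/
theorem halfPeriod_notMem_lattice {τ : ℂ} (hτ : 0 < τ.im) {a b : Fin 2} (h : ¬(a = 0 ∧ b = 0)) :
    halfPeriod τ a b ∉ lattice τ := by
  rintro ⟨m, k, hmk⟩
  have him := congr_arg Complex.im hmk
  have hre := congr_arg Complex.re hmk
  rw [halfPeriod] at him hre
  rcases fin_two_eq a with rfl | rfl <;> rcases fin_two_eq b with rfl | rfl
  · exact h ⟨rfl, rfl⟩
  · simp at him
    have h1 : (1 : ℝ) = 2 * k := mul_right_cancel₀ hτ.ne' (by linarith)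
    have h2 : (1 : ℤ) = 2 * k := by exact_mod_cast h1
    omega
  · simp at him hre
    have hk : k = 0 := by
      rcases him with hk | h0
      · exact hk
      · exact absurd h0 hτ.ne'
    subst hk
    have h1 : (1 : ℝ) = 2 * m := by push_cast at hre; linarith
    have h2 : (1 : ℤ) = 2 * m := by exact_mod_cast h1
    omega
  · simp at him
    have h1 : (1 : ℝ) = 2 * k := mul_right_cancel₀ hτ.ne' (by linarith)
    have h2 : (1 : ℤ) = 2 * k := by exact_mod_cast h1
    omega

/-- The genericity condition on `u`. -/
def Generic {n : ℕ} (τ : ℂ) (u : Fin (n / 2) → ℂ) : Prop :=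
  ∀ j k : Fin n, j ≠ k → ∀ a b : Fin 2, hatU u j - hatU u k + halfPeriod τ a b ∉ lattice τ

theorem Generic.notMem_lattice {n : ℕ} {τ : ℂ} (hτ : 0 < τ.im) {u : Fin (n / 2) → ℂ}
    (hu : Generic τ u) {a b : Fin 2} {j k : Fin n} (h : ¬(a = 0 ∧ b = 0 ∧ j = k)) :
    hatU u j - hatU u k + halfPeriod τ a b ∉ lattice τ := by
  by_cases hjk : j = k
  · subst hjk
    rw [sub_self, zero_add]
    exact halfPeriod_notMem_lattice hτ fun h' => h ⟨h'.1, h'.2, rfl⟩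
  · exact hu j k hjk a b

theorem Generic.notMem_lattice' {n : ℕ} {τ : ℂ} (hτ : 0 < τ.im) {u : Fin (n / 2) → ℂ}
    (hu : Generic τ u) {a b : Fin 2} {j k : Fin n} (h : ¬(a = 0 ∧ b = 0 ∧ j = k)) :
    -(hatU u j - hatU u k) + halfPeriod τ a b ∉ lattice τ := by
  rw [neg_sub]
  exact hu.notMem_lattice hτ fun h' => h ⟨h'.1, h'.2.1, h'.2.2.symm⟩

/-- The prefactor e(bz/2) is chosen for this: its multiplier e(bτ/2) cancels the part bτ/2 of the
half-period, and the part a/2 leaves the sign (-1)^a. -/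
theorem ee_multiplier {τ x : ℂ} (a b : Fin 2) :
    ee (((b : ℕ) : ℂ) / 2 * τ - (-x + halfPeriod τ a b)) = (-1) ^ (a : ℕ) * ee x := by
  have h : ((b : ℕ) : ℂ) / 2 * τ - (-x + halfPeriod τ a b) = -(((a : ℕ) : ℂ) / 2) + x := by
    rw [halfPeriod]; ring
  rw [h, ee_add, ee_neg, ee_half]
  rcases fin_two_eq a with rfl | rfl <;> simp

/-! ### Reduction of the Lax conditions to scalar functions -/

theorem coord_smul {n : ℕ} (r : ℂ) (X : Mat n) (α a b : Fin 2) (j k : Fin n) :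
    coord (r • X) α a b j k = r * coord X α a b j k := by
  rw [coord, coord, Matrix.smul_mul, Matrix.trace_smul, smul_eq_mul, mul_div_assoc]

theorem continuous_coord {n : ℕ} (α a b : Fin 2) (j k : Fin n) :
    Continuous fun X : Mat n => coord X α a b j k := by
  unfold coord
  exact (Continuous.matrix_trace (by fun_prop)).div_const _

theorem coord_differentiableOn {n : ℕ} {s : Set ℂ} {L : ℂ → Mat n}
    (hL : ∀ p q, DifferentiableOn ℂ (fun z => L z p q) s) (α a b : Fin 2) (j k : Fin n) :
    DifferentiableOn ℂ (fun z => coord (L z) α a b j k) s := by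
  simp only [coord, trace_mul_T]
  have h1 := fun p q => hL p q
  fun_prop

theorem coord_nu {n : ℕ} (X : Mat n) (α a b : Fin 2) {p : Fin n × Fin n} (hp : p ∈ pairs n) :
    coord (nu X) α a b p.1 p.2 = (-1) ^ (b : ℕ) * coord X α a b p.1 p.2 := by
  conv_lhs => rw [eq_combination_coord X, nu_combination, coord_combination _ _ _ _ hp]
  rw [mul_left_comm, support_mul_coord]

theorem coord_AdT {n : ℕ} (u : Fin (n / 2) → ℂ) (X : Mat n) (α a b : Fin 2) {p : Fin n × Fin n}
    (hp : p ∈ pairs n) : coord (AdT u X) α a b p.1 p.2 =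
      (-1) ^ (a : ℕ) * ee (hatU u p.1 - hatU u p.2) * coord X α a b p.1 p.2 := by
  conv_lhs => rw [eq_combination_coord X, AdT_combination, coord_combination _ _ _ _ hp]
  rw [mul_left_comm, support_mul_coord]

theorem IsLaxOperator.tendsto_coord {n : ℕ} {τ : ℂ} {u : Fin (n / 2) → ℂ} {S : Mat n}
    {L : ℂ → Mat n} (hL : IsLaxOperator τ u S L) (α a b : Fin 2) (j k : Fin n) :
    Tendsto (fun z => z * coord (L z) α a b j k) (𝓝[≠] 0) (𝓝 (coord S α a b j k)) := by
  refine (((continuous_coord α a b j k).tendsto S).comp hL.residue).congr fun z => ?_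
  exact coord_smul _ _ _ _ _ _ _

/-- The coordinate solves the scalar problem with the multipliers of e(bz/2) φ. Genericity, or the
half-period when j = k, keeps the first argument of φ off the lattice. -/
theorem IsLaxOperator.coord_eq {n : ℕ} {τ : ℂ} (hτ : 0 < τ.im) {u : Fin (n / 2) → ℂ}
    (hu : Generic τ u) {S : Mat n} {L : ℂ → Mat n} (hL : IsLaxOperator τ u S L) (α : Fin 2)
    {a b : Fin 2} {p : Fin n × Fin n} (hp : p ∈ pairs n) (h : ¬(a = 0 ∧ b = 0 ∧ p.1 = p.2))
    {z : ℂ} (hz : z ∉ lattice τ) : coord (L z) α a b p.1 p.2 =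
      coord S α a b p.1 p.2 * ee ((b : ℕ) * z / 2) *
        kronecker τ (-(hatU u p.1 - hatU u p.2) + halfPeriod τ a b) z := by
  have := eq_mul_ee_mul_kronecker hτ (β := ((b : ℕ) : ℂ) / 2) (hu.notMem_lattice' hτ h)
    (coord_differentiableOn hL.holomorphic α a b p.1 p.2)
    (fun z hz => by rw [hL.nu_equivariant z hz, coord_nu _ _ _ _ hp, ee_half])
    (fun z hz => by rw [hL.ad_equivariant z hz, coord_AdT _ _ _ _ _ hp, ee_multiplier])
    (hL.tendsto_coord α a b p.1 p.2) z hz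
  rw [this, mul_assoc, div_mul_eq_mul_div]

/-- Here both multipliers are 1, so the coordinate is elliptic. This is the only obstruction to a
residue S and the only source of free constants. -/
theorem IsLaxOperator.coord_diag {n : ℕ} {τ : ℂ} (hτ : 0 < τ.im) {u : Fin (n / 2) → ℂ}
    {S : Mat n} {L : ℂ → Mat n} (hL : IsLaxOperator τ u S L) (α : Fin 2) {j : Fin n}
    (hj : (j, j) ∈ pairs n) :
    coord S α 0 0 j j = 0 ∧ ∃ c, ∀ z ∉ lattice τ, coord (L z) α 0 0 j j = c :=
  residue_eq_zero_and_const hτ (coord_differentiableOn hL.holomorphic α 0 0 j j)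
    (fun z hz => by rw [hL.nu_equivariant z hz, coord_nu _ _ _ _ hj]; simp)
    (fun z hz => by rw [hL.ad_equivariant z hz, coord_AdT _ _ _ _ _ hj]; simp [ee_zero])
    (hL.tendsto_coord α 0 0 j j)

theorem lo'_mem_pairs {n : ℕ} (j : Fin ((n + 1) / 2)) :
    ((lo' j, lo' j) : Fin n × Fin n) ∈ pairs n := by
  rw [mem_pairs]
  have := j.isLt
  simp only [lo', Fin.val_castLE]
  omega

theorem lo_mem_pairs {n : ℕ} (j : Fin (n / 2)) : ((lo j, lo j) : Fin n × Fin n) ∈ pairs n := by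
  rw [mem_pairs]
  have := j.isLt
  simp only [lo, Fin.val_castLE]
  omega

theorem lo_ne_rev {n : ℕ} (j k : Fin (n / 2)) : (lo j : Fin n) ≠ (lo k).rev := by
  intro h
  have := congr_arg Fin.val h
  simp only [lo, Fin.val_rev, Fin.val_castLE] at this
  omega

theorem sgn_one_zero_zero : sgn 1 0 0 = 1 := by simp [sgn]

theorem support_lo {n : ℕ} (α a b : Fin 2) (j : Fin (n / 2)) :
    support α a b (lo j) (lo j : Fin n) = 1 := if_neg fun h => lo_ne_rev j j h.1

theorem support_one_zero_zero {n : ℕ} (j k : Fin n) : support 1 0 0 j k = 1 := by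
  refine if_neg fun h => ?_
  rw [sgn_one_zero_zero] at h
  norm_num at h

theorem combination_congr {n : ℕ} {c d : Fin 2 → Fin 2 → Fin 2 → Fin n × Fin n → ℂ}
    (h : ∀ α a b, ∀ p ∈ pairs n, c α a b p = d α a b p) : combination c = combination d :=
  Finset.sum_congr rfl fun α _ => Finset.sum_congr rfl fun a _ =>
    Finset.sum_congr rfl fun b _ => Finset.sum_congr rfl fun p hp => by rw [h α a b p hp]

theorem exists_notMem_lattice {τ : ℂ} (hτ : 0 < τ.im) : ∃ z, z ∉ lattice τ :=
  (eventually_notMem_lattice hτ 0).exists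

/-- A Lax operator has the explicit form. -/
theorem IsLaxOperator.exists_eq {n : ℕ} {τ : ℂ} (hτ : 0 < τ.im) {u : Fin (n / 2) → ℂ}
    (hu : Generic τ u) {S : Mat n} {L : ℂ → Mat n} (hL : IsLaxOperator τ u S L) :
    ∃ (v : Fin (n / 2) → ℂ) (w : Fin ((n + 1) / 2) → ℂ), ∀ z ∉ lattice τ,
      L z = laxOperator τ u v S z + centralTerm w := by
  obtain ⟨z₀, hz₀⟩ := exists_notMem_lattice hτ
  -- The coordinates taken as v and w are constant off the lattice, so any base point gives them.
  refine ⟨fun j => coord (L z₀) 0 0 0 (lo j) (lo j), fun j => coord (L z₀) 1 0 0 (lo' j) (lo' j),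
    fun z hz => ?_⟩
  rw [laxOperator_add_centralTerm]
  conv_lhs => rw [eq_combination_coord (L z)]
  refine combination_congr fun α a b p hp => ?_
  unfold laxCoeff
  split_ifs with h hα
  · obtain ⟨j, k⟩ := p
    obtain ⟨rfl, rfl, hjk⟩ := h
    simp only at hjk ⊢
    subst hjk hα
    obtain ⟨-, c, hc⟩ := hL.coord_diag hτ 0 hp
    unfold extendZero
    split_ifs with hj
    · rw [hc z hz]
      exact (hc z₀ hz₀).symm
    -- Only the middle index 2j + 1 = n (counted from 0) remains. The generator T^0_{(0,0),jj} is
    -- zero there, and so is its coordinate.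
    · rw [mem_pairs] at hp
      rw [← support_mul_coord, support, if_pos, zero_mul]
      refine ⟨?_, by simp [sgn]⟩
      simp only at hp
      rw [Fin.ext_iff, Fin.val_rev]
      omega
  · obtain ⟨j, k⟩ := p
    obtain ⟨rfl, rfl, hjk⟩ := h
    have hα1 := (fin_two_eq α).resolve_left hα
    simp only at hjk ⊢
    subst hjk hα1
    obtain ⟨-, c, hc⟩ := hL.coord_diag hτ 1 hp
    rw [mem_pairs] at hp
    simp only at hp
    rw [extendZero, dif_pos (by omega), hc z hz]
    exact (hc z₀ hz₀).symm
  · exact hL.coord_eq hτ hu α hp h hz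

/-- The parameters of the explicit Lax operator are unique. -/
theorem lax_parameters_unique {n : ℕ} {τ : ℂ} {u v v' : Fin (n / 2) → ℂ}
    {w w' : Fin ((n + 1) / 2) → ℂ} {S : Mat n} {z : ℂ}
    (h : laxOperator τ u v S z + centralTerm w = laxOperator τ u v' S z + centralTerm w') :
    v = v' ∧ w = w' := by
  rw [laxOperator_add_centralTerm, laxOperator_add_centralTerm] at h
  constructor
  · funext j
    have := combination_eq_iff h 0 0 0 (lo_mem_pairs j)
    simpa [support_lo, laxCoeff, extendZero_lo] using this
  · funext j
    have := combination_eq_iff h 1 0 0 (lo'_mem_pairs j)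
    simpa [support_one_zero_zero, laxCoeff, extendZero_lo'] using this

/-! ### The explicit functions satisfy the Lax conditions -/

theorem trace_T {n : ℕ} (α a b : Fin 2) (j k : Fin n) : (T α a b j k).trace =
    if α = 0 ∧ a = 0 ∧ b = 1 ∧ j = k then 4 else 0 := by
  have h := trace_mul_T 1 α a b j k
  rw [one_mul] at h
  rw [h]
  by_cases hjk : j = k
  · subst hjk
    rcases fin_two_eq α with rfl | rfl <;> rcases fin_two_eq a with rfl | rfl <;>
      rcases fin_two_eq b with rfl | rfl <;> (simp [pauli_eq, sgn]; try norm_num)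
  · have : ¬ k = j := fun h => hjk h.symm
    simp [hjk, this]

theorem trace_combination {n : ℕ} (c : Fin 2 → Fin 2 → Fin 2 → Fin n × Fin n → ℂ) :
    (combination c).trace = ∑ p ∈ pairs n, if p.1 = p.2 then 4 * c 0 0 1 p else 0 := by
  have h := trace_combination_mul c 1
  simp only [mul_one, trace_T] at h
  rw [h]
  simp [Fin.sum_univ_two, mul_comm]

theorem diag_coord_eq_zero {n : ℕ} {S : Mat n}
    (hS : ∀ (α : Fin 2) (j : Fin ((n + 1) / 2)), coord S α 0 0 (lo' j) (lo' j) = 0)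
    (α : Fin 2) {a b : Fin 2} {p : Fin n × Fin n} (hp : p ∈ pairs n)
    (h : a = 0 ∧ b = 0 ∧ p.1 = p.2) : coord S α a b p.1 p.2 = 0 := by
  obtain ⟨j, k⟩ := p
  obtain ⟨rfl, rfl, hjk⟩ := h
  simp only at hjk
  subst hjk
  rw [mem_pairs] at hp
  simp only at hp
  exact hS α ⟨j.val, by omega⟩

theorem laxCoeff_of_not {n : ℕ} (τ : ℂ) (u v : Fin (n / 2) → ℂ) (w : Fin ((n + 1) / 2) → ℂ)
    (S : Mat n) (α : Fin 2) {a b : Fin 2} {p : Fin n × Fin n} (h : ¬(a = 0 ∧ b = 0 ∧ p.1 = p.2))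
    (z : ℂ) : laxCoeff τ u v w S z α a b p = coord S α a b p.1 p.2 *
      (ee (((b : ℕ) : ℂ) / 2 * z) *
        kronecker τ (-(hatU u p.1 - hatU u p.2) + halfPeriod τ a b) z) := by
  rw [laxCoeff, if_neg h, mul_assoc, div_mul_eq_mul_div]

theorem laxCoeff_add_one {n : ℕ} (τ : ℂ) (u v : Fin (n / 2) → ℂ) (w : Fin ((n + 1) / 2) → ℂ)
    (S : Mat n) (z : ℂ) (α a b : Fin 2) (p : Fin n × Fin n) :
    laxCoeff τ u v w S (z + 1) α a b p = (-1) ^ (b : ℕ) * laxCoeff τ u v w S z α a b p := by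
  by_cases h : a = 0 ∧ b = 0 ∧ p.1 = p.2
  · rw [laxCoeff, laxCoeff, if_pos h, if_pos h, h.2.1]
    simp
  · rw [laxCoeff_of_not _ _ _ _ _ _ h, laxCoeff_of_not _ _ _ _ _ _ h, ee_mul_kronecker_add_one,
      ee_half]
    ring

theorem laxCoeff_add_tau {n : ℕ} (τ : ℂ) (u v : Fin (n / 2) → ℂ) (w : Fin ((n + 1) / 2) → ℂ)
    (S : Mat n) (z : ℂ) (α a b : Fin 2) (p : Fin n × Fin n) :
    laxCoeff τ u v w S (z + τ) α a b p =
      (-1) ^ (a : ℕ) * ee (hatU u p.1 - hatU u p.2) * laxCoeff τ u v w S z α a b p := by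
  by_cases h : a = 0 ∧ b = 0 ∧ p.1 = p.2
  · rw [laxCoeff, laxCoeff, if_pos h, if_pos h, h.1, h.2.2]
    simp [ee_zero]
  · rw [laxCoeff_of_not _ _ _ _ _ _ h, laxCoeff_of_not _ _ _ _ _ _ h, ee_mul_kronecker_add_tau,
      ee_multiplier]
    ring

theorem laxCoeff_differentiableOn {n : ℕ} {τ : ℂ} (hτ : 0 < τ.im) {u : Fin (n / 2) → ℂ}
    (hu : Generic τ u) (v : Fin (n / 2) → ℂ) (w : Fin ((n + 1) / 2) → ℂ) (S : Mat n)
    (α a b : Fin 2) (p : Fin n × Fin n) :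
    DifferentiableOn ℂ (fun z => laxCoeff τ u v w S z α a b p) (lattice τ)ᶜ := by
  by_cases h : a = 0 ∧ b = 0 ∧ p.1 = p.2
  · simp only [laxCoeff, if_pos h]
    exact differentiableOn_const _
  · simp only [laxCoeff_of_not _ _ _ _ _ _ h]
    exact (ee_mul_kronecker_differentiableOn hτ _ (hu.notMem_lattice' hτ h)).const_mul _

theorem tendsto_mul_laxCoeff {n : ℕ} {τ : ℂ} (hτ : 0 < τ.im) {u : Fin (n / 2) → ℂ}
    (hu : Generic τ u) (v : Fin (n / 2) → ℂ) (w : Fin ((n + 1) / 2) → ℂ) {S : Mat n}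
    (hS : ∀ (α : Fin 2) (j : Fin ((n + 1) / 2)), coord S α 0 0 (lo' j) (lo' j) = 0)
    (α a b : Fin 2) {p : Fin n × Fin n} (hp : p ∈ pairs n) :
    Tendsto (fun z => z * laxCoeff τ u v w S z α a b p) (𝓝[≠] 0)
      (𝓝 (coord S α a b p.1 p.2)) := by
  by_cases h : a = 0 ∧ b = 0 ∧ p.1 = p.2
  · rw [diag_coord_eq_zero hS α hp h]
    simp only [laxCoeff, if_pos h]
    generalize (if α = 0 then extendZero v p.1 else extendZero w p.1) = c
    have : Tendsto (fun z : ℂ => z * c) (𝓝 0) (𝓝 (0 * c)) := Continuous.tendsto (by fun_prop) 0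
    rw [zero_mul] at this
    exact this.mono_left nhdsWithin_le_nhds
  · have := (tendsto_mul_ee_mul_kronecker hτ (((b : ℕ) : ℂ) / 2)
      (hu.notMem_lattice' hτ h)).const_mul (coord S α a b p.1 p.2)
    rw [mul_one] at this
    refine this.congr fun z => ?_
    rw [laxCoeff_of_not _ _ _ _ _ _ h]
    ring

theorem combination_smul {n : ℕ} (r : ℂ) (c : Fin 2 → Fin 2 → Fin 2 → Fin n × Fin n → ℂ) :
    r • combination c = combination fun α a b p => r * c α a b p := by
  simp only [combination, Finset.smul_sum, smul_smul]

/-- The explicit functions are Lax operators. -/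
theorem isLaxOperator_of_eq {n : ℕ} {τ : ℂ} (hτ : 0 < τ.im) {u : Fin (n / 2) → ℂ}
    (hu : Generic τ u) {v : Fin (n / 2) → ℂ} {w : Fin ((n + 1) / 2) → ℂ} {S : Mat n}
    (htr : S.trace = 0)
    (hS : ∀ (α : Fin 2) (j : Fin ((n + 1) / 2)), coord S α 0 0 (lo' j) (lo' j) = 0)
    {L : ℂ → Mat n} (hL : ∀ z ∉ lattice τ, L z = laxOperator τ u v S z + centralTerm w) :
    IsLaxOperator τ u S L := by
  simp only [laxOperator_add_centralTerm] at hL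
  have h1 : ∀ z ∉ lattice τ, z + 1 ∉ lattice τ := fun z hz h =>
    hz ((add_mem_lattice (one_mem_lattice τ)).1 h)
  have h2 : ∀ z ∉ lattice τ, z + τ ∉ lattice τ := fun z hz h =>
    hz ((add_mem_lattice (tau_mem_lattice τ)).1 h)
  refine ⟨fun z hz => ?_, fun p q => ?_, fun z hz => ?_, fun z hz => ?_, ?_⟩
  · rw [hL z hz, trace_combination]
    have h3 := htr
    rw [eq_combination_coord S, trace_combination] at h3
    -- Only the generators T^0_{(0,1),jj} have a trace. As u_jj = 0, they all carry the same scalar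
    -- function, so the trace of L is this function times tr S = 0.
    have h4 : ∀ p : Fin n × Fin n, (if p.1 = p.2 then 4 * laxCoeff τ u v w S z 0 0 1 p else 0) =
        (if p.1 = p.2 then 4 * coord S 0 0 1 p.1 p.2 else 0) *
          (ee (z / 2) * kronecker τ (halfPeriod τ 0 1) z) := by
      intro p
      split_ifs with h
      · rw [laxCoeff_of_not _ _ _ _ _ _ (by simp), h]
        simp
        ring_nf
      · rw [zero_mul]
    simp only [h4, ← Finset.sum_mul, h3, zero_mul]
  · have : DifferentiableOn ℂ (fun z => combination (laxCoeff τ u v w S z) p q) (lattice τ)ᶜ := by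
      have hd := laxCoeff_differentiableOn hτ hu v w S
      simp only [combination, Matrix.sum_apply, Matrix.smul_apply, smul_eq_mul]
      fun_prop
    exact this.congr fun z hz => by rw [hL z hz]
  · rw [hL z hz, hL _ (h1 z hz), nu_combination]
    exact combination_congr fun α a b p _ => laxCoeff_add_one _ _ _ _ _ _ _ _ _ _
  · rw [hL z hz, hL _ (h2 z hz), AdT_combination]
    exact combination_congr fun α a b p _ => laxCoeff_add_tau _ _ _ _ _ _ _ _ _ _
  · rw [eq_combination_coord S]
    have : Tendsto (fun z => combination fun α a b p => z * laxCoeff τ u v w S z α a b p) (𝓝[≠] 0)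
        (𝓝 (combination fun α a b p => coord S α a b p.1 p.2)) :=
      tendsto_finsetSum _ fun α _ => tendsto_finsetSum _ fun a _ => tendsto_finsetSum _ fun b _ =>
        tendsto_finsetSum _ fun p hp =>
          (tendsto_mul_laxCoeff hτ hu v w hS α a b hp).smul_const _
    refine this.congr' ?_
    filter_upwards [eventually_notMem_lattice hτ 0] with z hz
    rw [hL z hz, combination_smul]

/-! ### The quadratic Hamiltonian -/

/-- Since 2ω_ab = a + bτ and φ is symmetric in its two arguments, the quasi-periods in z apply to
the first argument as well. -/
theorem kronecker_neg_add_periods (τ x z : ℂ) (a b : Fin 2) :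
    kronecker τ (-x + 2 * halfPeriod τ a b) z = ee (-((b : ℕ) * z)) * kronecker τ (-x) z := by
  have h1 : ∀ y, kronecker τ (y + 1) z = kronecker τ y z := fun y => by
    rw [kronecker_comm, kronecker_add_one, kronecker_comm]
  have h2 : ∀ y, kronecker τ (y + τ) z = ee (-z) * kronecker τ y z := fun y => by
    rw [kronecker_comm, kronecker_add_tau, kronecker_comm]
  have e : -x + 2 * halfPeriod τ a b = -x + (b : ℕ) * τ + (a : ℕ) := by rw [halfPeriod]; ring
  rw [e]
  rcases fin_two_eq a with rfl | rfl <;> rcases fin_two_eq b with rfl | rfl <;>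
    simp [h1, h2, ee_zero]

theorem E2_neg_add_periods {τ : ℂ} (hτ : 0 < τ.im) {x : ℂ} (hx : x ∉ lattice τ) (a b : Fin 2) :
    E2 τ (-x + 2 * halfPeriod τ a b) = E2 τ x := by
  have e : -x + 2 * halfPeriod τ a b = -x + (b : ℕ) * τ + (a : ℕ) := by rw [halfPeriod]; ring
  have hx' : -x ∉ lattice τ := fun h => hx (neg_mem_lattice.1 h)
  rw [e]
  rcases fin_two_eq a with rfl | rfl <;> rcases fin_two_eq b with rfl | rfl <;>
    simp [E2_add_one, E2_add_tau hτ hx', E2_neg]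

/-- The two arguments are exchanged by x ↦ -x + 2ω_ab; E₂ is even and 2ω_ab is a period. This
supplies the symmetry required by `sum_pairs_symm`. -/
theorem E2_hatU_comm {n : ℕ} {τ : ℂ} (hτ : 0 < τ.im) {u : Fin (n / 2) → ℂ} (hu : Generic τ u)
    (a b : Fin 2) (j k : Fin n) : E2 τ (hatU u j - hatU u k + halfPeriod τ a b) =
      E2 τ (hatU u k - hatU u j + halfPeriod τ a b) := by
  by_cases h : j = k
  · rw [h]
  · rw [← E2_neg_add_periods hτ (hu j k h a b) a b]
    ring_nf

/-- With x = u_jk + ω_ab, the kj coefficient contains φ(x, z) and the jk coefficient φ(-x + 2ω_ab,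
z) = e(-bz) φ(-x, z). The factor e(-bz) cancels the two prefactors e(bz/2). -/
theorem laxCoeff_mul_laxCoeff_swap {n : ℕ} {τ : ℂ} (hτ : 0 < τ.im) {u : Fin (n / 2) → ℂ}
    (hu : Generic τ u) (v : Fin (n / 2) → ℂ) (w : Fin ((n + 1) / 2) → ℂ) (S : Mat n) (α : Fin 2)
    {a b : Fin 2} {p : Fin n × Fin n} (h : ¬(a = 0 ∧ b = 0 ∧ p.1 = p.2)) {z : ℂ}
    (hz : z ∉ lattice τ) :
    laxCoeff τ u v w S z α a b p * laxCoeff τ u v w S z α a b p.swap =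
      coord S α a b p.1 p.2 * coord S α a b p.2 p.1 *
        (E2 τ z - E2 τ (hatU u p.1 - hatU u p.2 + halfPeriod τ a b)) := by
  have h' : ¬(a = 0 ∧ b = 0 ∧ p.swap.1 = p.swap.2) := fun h' => h ⟨h'.1, h'.2.1, h'.2.2.symm⟩
  rw [laxCoeff_of_not _ _ _ _ _ _ h, laxCoeff_of_not _ _ _ _ _ _ h', Prod.fst_swap,
    Prod.snd_swap, neg_sub (hatU u p.2)]
  have hx := hu.notMem_lattice hτ h
  rw [← kronecker_mul_kronecker_neg hτ hx hz]
  set x := hatU u p.1 - hatU u p.2 + halfPeriod τ a b with hxd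
  have e : -(hatU u p.1 - hatU u p.2) + halfPeriod τ a b = -x + 2 * halfPeriod τ a b := by
    rw [hxd]; ring
  have e2 : ee (((b : ℕ) : ℂ) / 2 * z) * ee (((b : ℕ) : ℂ) / 2 * z) * ee (-((b : ℕ) * z)) = 1 := by
    rw [← ee_add, ← ee_add, ← ee_zero]; ring_nf
  rw [e, kronecker_neg_add_periods]
  linear_combination coord S α a b p.1 p.2 * coord S α a b p.2 p.1 * kronecker τ (-x) z *
    kronecker τ x z * e2

theorem hatU_lo {n : ℕ} (u : Fin (n / 2) → ℂ) (j : Fin (n / 2)) : hatU u (lo j : Fin n) = u j :=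
  dif_pos j.isLt

theorem hatU_middle {n : ℕ} (u : Fin (n / 2) → ℂ) {m : Fin n} (hm : m ∈ middle n) :
    hatU u m = 0 := by
  have := hatU_rev u m
  rw [(Finset.mem_filter.1 hm).2] at this
  exact CharZero.eq_neg_self_iff.1 this

theorem lo_ne_middle {n : ℕ} (j : Fin (n / 2)) {m : Fin n} (hm : m ∈ middle n) : lo j ≠ m := by
  rintro rfl
  exact lo_ne_rev j j (Finset.mem_filter.1 hm).2.symm

/-- The folded sum is evaluated with û equal to u_j at an index j ≤ l, to -u_k at the reversal of k,
and to 0 at the middle index. -/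
theorem sum_pairs_potential {n : ℕ} {τ : ℂ} (hτ : 0 < τ.im) {u : Fin (n / 2) → ℂ}
    (hu : Generic τ u) (s : Fin n → Fin n → ℂ) (a b : Fin 2) :
    ∑ p ∈ pairs n, normT p.1 p.2 / 8 * (if a = 0 ∧ b = 0 ∧ p.1 = p.2 then 0 else
      s p.1 p.2 * s p.2 p.1 * E2 τ (hatU u p.1 - hatU u p.2 + halfPeriod τ a b)) =
    (if a = 0 ∧ b = 0 then 0 else
        ((1 / 2) * ∑ j, s (lo j) (lo j) ^ 2 + ∑ m ∈ middle n, s m m ^ 2) *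
          E2 τ (halfPeriod τ a b)) +
      (∑ j, ∑ k with j < k,
        (s (lo j) (lo k) * s (lo k) (lo j) * E2 τ (u j - u k + halfPeriod τ a b) +
          s (lo j) (lo k).rev * s (lo k).rev (lo j) * E2 τ (u j + u k + halfPeriod τ a b))) +
      (∑ j, ∑ m ∈ middle n, s (lo j) m * s m (lo j) * E2 τ (u j + halfPeriod τ a b)) +
      2 * ∑ j, s (lo j) (lo j).rev * s (lo j).rev (lo j) *
        E2 τ (2 * u j + halfPeriod τ a b) := by
  rw [sum_pairs_symm (fun j k => if a = 0 ∧ b = 0 ∧ j = k then 0 else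
      s j k * s k j * E2 τ (hatU u j - hatU u k + halfPeriod τ a b))]
  · congr 1
    · congr 1
      · congr 1
        · by_cases h : a = 0 ∧ b = 0
          · simp [h.1, h.2]
          · simp only [and_true, if_neg h, sub_self, zero_add, ← sq, ← Finset.sum_mul]
            ring
        · refine Finset.sum_congr rfl fun j _ => Finset.sum_congr rfl fun k hk => ?_
          have hjk : (lo j : Fin n) ≠ lo k := fun h =>
            (Finset.mem_filter.1 hk).2.ne (Fin.castLE_injective _ h)
          rw [if_neg fun h => hjk h.2.2, if_neg fun h => lo_ne_rev j k h.2.2, hatU_rev,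
            hatU_lo, hatU_lo, sub_neg_eq_add]
      · refine Finset.sum_congr rfl fun j _ => Finset.sum_congr rfl fun m hm => ?_
        rw [if_neg fun h => lo_ne_middle j hm h.2.2, hatU_lo, hatU_middle u hm, sub_zero]
    · congr 1
      refine Finset.sum_congr rfl fun j _ => ?_
      rw [if_neg fun h => lo_ne_rev j j h.2.2, hatU_rev, hatU_lo, sub_neg_eq_add, two_mul]
  · intro j k
    rw [E2_hatU_comm hτ hu a b j k]
    simp only [@eq_comm _ j k, mul_comm (s j k)]

/-- The trace of the square of the Lax operator. -/
theorem trace_lax_sq {n : ℕ} {τ : ℂ} (hτ : 0 < τ.im) {u : Fin (n / 2) → ℂ} (hu : Generic τ u)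
    {S : Mat n} (hS : ∀ (α : Fin 2) (j : Fin ((n + 1) / 2)), coord S α 0 0 (lo' j) (lo' j) = 0)
    (v : Fin (n / 2) → ℂ) (w : Fin ((n + 1) / 2) → ℂ) {z : ℂ} (hz : z ∉ lattice τ) :
    (1 / 8) * ((laxOperator τ u v S z + centralTerm w) ^ 2).trace =
      hamiltonian τ u v S + ∑ j, normT (lo' j : Fin n) (lo' j) / 8 * w j ^ 2 +
        E2 τ z * ((1 / 8) * (S ^ 2).trace) := by
  -- Each basis element contributes either a constant square (a = b = 0, j = k) or a multiple of
  -- E₂(z) - E₂(x). In the potential the indicator `support` can be dropped, because the coordinates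
  -- of S already vanish at zero generators.
  have hterm : ∀ α a b, ∀ p ∈ pairs n, normT p.1 p.2 * support α a b p.1 p.2 *
      (laxCoeff τ u v w S z α a b p * laxCoeff τ u v w S z α a b p.swap) =
      8 * (if a = 0 then if b = 0 then if p.1 = p.2 then normT p.1 p.1 / 8 * support α 0 0 p.1 p.1 *
        (if α = 0 then extendZero v p.1 else extendZero w p.1) ^ 2 else 0 else 0 else 0) -
      8 * (normT p.1 p.2 / 8 * (if a = 0 ∧ b = 0 ∧ p.1 = p.2 then 0 else
        coord S α a b p.1 p.2 * coord S α a b p.2 p.1 *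
          E2 τ (hatU u p.1 - hatU u p.2 + halfPeriod τ a b))) +
      E2 τ z * (normT p.1 p.2 * support α a b p.1 p.2 *
        (coord S α a b p.1 p.2 * coord S α a b p.swap.1 p.swap.2)) := by
    intro α a b p hp
    by_cases h : a = 0 ∧ b = 0 ∧ p.1 = p.2
    · rw [diag_coord_eq_zero hS α hp h, if_pos h.1, if_pos h.2.1, if_pos h.2.2, if_pos h]
      have h' : a = 0 ∧ b = 0 ∧ p.swap.1 = p.swap.2 := ⟨h.1, h.2.1, h.2.2.symm⟩
      rw [laxCoeff, laxCoeff, if_pos h, if_pos h', Prod.fst_swap, ← h.2.2, h.1, h.2.1]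
      ring
    · have h0 : (if a = 0 then if b = 0 then if p.1 = p.2 then
          normT p.1 p.1 / 8 * support α 0 0 p.1 p.1 *
          (if α = 0 then extendZero v p.1 else extendZero w p.1) ^ 2 else 0 else 0 else 0) = 0 := by
        split_ifs with h1 h2 h3 <;> first | rfl | exact absurd ⟨h1, h2, h3⟩ h
      rw [h0, if_neg h, laxCoeff_mul_laxCoeff_swap hτ hu v w S α h hz, Prod.fst_swap,
        Prod.snd_swap]
      linear_combination (-normT p.1 p.2 * coord S α a b p.2 p.1 *
        E2 τ (hatU u p.1 - hatU u p.2 + halfPeriod τ a b)) * support_mul_coord S α a b p.1 p.2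
  -- The indices of v are never on the antidiagonal, so the weight is 4/8 = 1/2. For w the middle
  -- index has weight 8/8 = 1, which gives the extra term of c(w) for odd n.
  have hdiag : ∑ α : Fin 2, ∑ a : Fin 2, ∑ b : Fin 2, ∑ p ∈ pairs n,
      (if a = 0 then if b = 0 then if p.1 = p.2 then normT p.1 p.1 / 8 * support α 0 0 p.1 p.1 *
        (if α = 0 then extendZero v p.1 else extendZero w p.1) ^ 2 else 0 else 0 else 0) =
      (1 / 2) * ∑ j, v j ^ 2 + ∑ j, normT (lo' j : Fin n) (lo' j) / 8 * w j ^ 2 := by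
    simp only [Fin.sum_univ_two, if_true, one_ne_zero, if_false, Finset.sum_const_zero, add_zero]
    rw [sum_pairs_diag fun j : Fin n => normT j j / 8 * support 0 0 0 j j * extendZero v j ^ 2,
      sum_pairs_diag fun j : Fin n => normT j j / 8 * support 1 0 0 j j * extendZero w j ^ 2,
      sum_lo'_eq_sum_lo fun j : Fin n => normT j j / 8 * support 0 0 0 j j * extendZero v j ^ 2]
    · simp only [extendZero_lo, extendZero_lo', support_lo, support_one_zero_zero, mul_one,
        Finset.mul_sum]
      congr 1
      refine Finset.sum_congr rfl fun j _ => ?_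
      rw [normT, if_neg (lo_ne_rev j j)]
      norm_num
    · intro j hj
      rw [extendZero, dif_neg hj]
      ring
  have hSsq : (S ^ 2).trace = ∑ α, ∑ a, ∑ b, ∑ p ∈ pairs n,
      normT p.1 p.2 * support α a b p.1 p.2 *
        (coord S α a b p.1 p.2 * coord S α a b p.swap.1 p.swap.2) := by
    conv_lhs => rw [eq_combination_coord S]
    exact trace_combination_sq _
  rw [laxOperator_add_centralTerm, trace_combination_sq, hSsq]
  simp only [Finset.sum_congr rfl (hterm _ _ _), Finset.sum_add_distrib, Finset.sum_sub_distrib,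
    ← Finset.mul_sum, hdiag, sum_pairs_potential hτ hu]
  rw [hamiltonian]
  simp only [Finset.sum_add_distrib, ← Finset.mul_sum]
  ring

end TwistedCM

/-! ### The theorem -/

theorem mainTheorem9 (n : ℕ) (τ : ℂ) (hτ : 0 < τ.im)
    (u : Fin (n / 2) → ℂ)
    (hu : ∀ j k : Fin n, j ≠ k → ∀ a b : Fin 2,
      TwistedCM.hatU u j - TwistedCM.hatU u k + TwistedCM.halfPeriod τ a b ∉ TwistedCM.lattice τ)
    (S : TwistedCM.Mat n) (hS : S.trace = 0) :
    -- the coordinates of the residue in the graded basis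
    S = ∑ α : Fin 2, ∑ a : Fin 2, ∑ b : Fin 2, ∑ p ∈ TwistedCM.pairs n,
      TwistedCM.coord S α a b p.1 p.2 • TwistedCM.T α a b p.1 p.2 ∧
    -- the Lax operators with residue `S`
    (∀ L : ℂ → TwistedCM.Mat n,
      TwistedCM.IsLaxOperator τ u S L ↔
        (∀ (α : Fin 2) (j : Fin ((n + 1) / 2)),
          TwistedCM.coord S α 0 0 (TwistedCM.lo' j) (TwistedCM.lo' j) = 0) ∧
        ∃! vw : (Fin (n / 2) → ℂ) × (Fin ((n + 1) / 2) → ℂ),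
          ∀ z ∉ TwistedCM.lattice τ,
            L z = TwistedCM.laxOperator τ u vw.1 S z + TwistedCM.centralTerm vw.2) ∧
    -- the quadratic Hamiltonian
    ((∀ (α : Fin 2) (j : Fin ((n + 1) / 2)),
        TwistedCM.coord S α 0 0 (TwistedCM.lo' j) (TwistedCM.lo' j) = 0) →
      ∀ (v : Fin (n / 2) → ℂ) (w : Fin ((n + 1) / 2) → ℂ), ∀ z ∉ TwistedCM.lattice τ,
        (1 / 8) * ((TwistedCM.laxOperator τ u v S z + TwistedCM.centralTerm w) ^ 2).trace =
          TwistedCM.hamiltonian τ u v S +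
          ∑ j, TwistedCM.normT (TwistedCM.lo' j) (TwistedCM.lo' j) / 8 * w j ^ 2 +
          TwistedCM.E2 τ z * ((1 / 8) * (S ^ 2).trace)) := by
  refine ⟨TwistedCM.eq_combination_coord S, fun L => ⟨fun hL => ⟨fun α j =>
    (hL.coord_diag hτ α (TwistedCM.lo'_mem_pairs j)).1, ?_⟩, ?_⟩,
    fun h0 v w z hz => TwistedCM.trace_lax_sq hτ hu h0 v w hz⟩
  · obtain ⟨v, w, h⟩ := hL.exists_eq hτ hu
    refine ⟨(v, w), h, ?_⟩
    rintro ⟨v', w'⟩ h'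
    -- Agreement at a single point off the lattice already determines v and w.
    obtain ⟨z, hz⟩ := TwistedCM.exists_notMem_lattice hτ
    obtain ⟨rfl, rfl⟩ := TwistedCM.lax_parameters_unique ((h' z hz).symm.trans (h z hz))
    rfl
  · rintro ⟨h0, vw, h, -⟩
    exact TwistedCM.isLaxOperator_of_eq hτ hu hS h0 h
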